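/- Let $q,w$ be real with either $-1<q\le 1$ and $w\neq 0$, or $q=-1$ and $w>0$. Let $f$ be a real function that is real-analytic at every point of $(0,1]$ and satisfies $\int_0^1|f(u)|\,du<\infty$. For integers $n\ge 1$ put \[ I_n=\int_0^1 f(u)\,(1+q\,u^n)^{w/n}\,du . \] For integers $m,k\ge 1$ let \[ S_{m,k}(z)=\frac{(-1)^{m+k-1}}{(m-1)!\,k!}\int_0^1\log^{m-1}(t)\,\log^{k}(1-zt)\,\frac{dt}{t} \] be Nielsen's generalized polylogarithm, and for integers $\nu\ge 0$ let \[ \beta_\nu=(-1)^\nu\sum_{\ell=0}^{\nu}\left\{{\nu+1\atop \ell+1}\right\}f^{(\ell)}(1), \] where $\left\{{a\atop b}\right\}$ are the Stirling numbers of the second kind. The integrals defining $I_n$ and $S_{m,k}(-q)$ converge absolutely, and as $n\to\infty$ through the integers there is the full asymptotic expansion \[ I_n\sim\int_0^1 f(u)\,du+\sum_{p=2}^{\infty}\frac{a_p}{n^p},\qquad a_p=\sum_{\ell=1}^{p-1}(-w)^{p-\ell}\,\beta_{\ell-1}\,S_{\ell,p-\ell}(-q), \] that is, for every integer $N\ge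 0$, $I_n=\int_0^1 f(u)\,du+\sum_{p=2}^{N}a_pn^{-p}+o(n^{-N})$. If $q=-1$, then for all $p\ge 2$ \[ a_p=\sum_{\ell=1}^{p-1}(-w)^{p-\ell}\,\beta_{\ell-1}\,\zeta(\ell+1,\{1\}_{p-\ell-1}), \] and each multiple zeta value $\zeta(\ell+1,\{1\}_{p-\ell-1})$ occurring here is a polynomial with rational coefficients in the ordinary zeta values $\zeta(2),\zeta(3),\dots$. If $q=1$, then for all $p\ge 2$ \[ a_p=\sum_{\ell=1}^{p-1}(-w)^{p-\ell}\,\beta_{\ell-1}\,\zeta(\overline{\ell+1},\{1\}_{p-\ell-1}). \] Here $\{1\}_j$ denotes $j$ arguments equal to $1$, \[ \zeta(i_1,\dots,i_k)=\sum_{n_1>\cdots>n_k\ge 1}\frac{1}{n_1^{i_1}\cdots n_k^{i_k}},\qquad \zeta(\overline{i_1},i_2,\dots,i_k)=\sum_{n_1>\cdots>n_k\ge 1}\frac{(-1)^{n_1}}{n_1^{i_1}\cdots n_k^{i_k}}, \] and the series occurring above converge. -/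

import Mathlib

open MeasureTheory Filter Topology Asymptotics

noncomputable section

/-- The integrand `f(u) (1 + q uⁿ)^{w/n}`. -/
def mainIntegrand (f : ℝ → ℝ) (q w : ℝ) (n : ℕ) (u : ℝ) : ℝ :=
  f u * (1 + q * u ^ n) ^ (w / (n : ℝ))

/-- `I_n = ∫₀¹ f(u) (1 + q uⁿ)^{w/n} du`. -/
def mainIntegral (f : ℝ → ℝ) (q w : ℝ) (n : ℕ) : ℝ :=
  ∫ u in (0 : ℝ)..1, mainIntegrand f q w n u

/-- The integrand `log^{m-1}(t) log^p(1 - z t) / t` of Nielsen's generalized polylogarithm. -/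
def nielsenIntegrand (m p : ℕ) (z t : ℝ) : ℝ :=
  Real.log t ^ (m - 1) * Real.log (1 - z * t) ^ p / t

/-- Nielsen's generalized polylogarithm `S_{m,p}(z)`, for `m, p ≥ 1` and real `z ≤ 1`. -/
def nielsenS (m p : ℕ) (z : ℝ) : ℝ :=
  (-1) ^ (m + p - 1) / ((Nat.factorial (m - 1) : ℝ) * (Nat.factorial p : ℝ)) *
    ∫ t in (0 : ℝ)..1, nielsenIntegrand m p z t

/-- `β_ν = (-1)^ν ∑_{ℓ=0}^ν {ν+1 over ℓ+1} f^{(ℓ)}(1)`. -/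
def betaCoeff (f : ℝ → ℝ) (ν : ℕ) : ℝ :=
  (-1) ^ ν * ∑ l ∈ Finset.range (ν + 1),
    (Nat.stirlingSecond (ν + 1) (l + 1) : ℝ) * iteratedDeriv l f 1

/-- `a_p = ∑_{ℓ=1}^{p-1} (-w)^{p-ℓ} β_{ℓ-1} S_{ℓ,p-ℓ}(-q)`. -/
def expansionCoeff (f : ℝ → ℝ) (q w : ℝ) (p : ℕ) : ℝ :=
  ∑ l ∈ Finset.Icc 1 (p - 1), (-w) ^ (p - l) * betaCoeff f (l - 1) * nielsenS l (p - l) (-q)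

/-- The partial sums of alternating multiple zeta values. An entry `(s, b)` of the list is an
exponent `s`, barred if `b = true`; `mzvTrunc [(s₁, b₁), …, (s_k, b_k)] N` is the sum, over
`N ≥ n₁ > ⋯ > n_k ≥ 1`, of `1 / (n₁^{s₁} ⋯ n_k^{s_k})` times the product of the signs
`(-1)^{n_i}` over the barred places `i`. -/
def mzvTrunc : List (ℕ × Bool) → ℕ → ℝ
  | [], _ => 1
  | (s, b) :: t, N => ∑ n ∈ Finset.Icc 1 N,
      (if b then (-1 : ℝ) ^ n else 1) / (n : ℝ) ^ s * mzvTrunc t (n - 1)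

/-- The (alternating) multiple zeta value: the limit of its partial sums. -/
def mzv (t : List (ℕ × Bool)) : ℝ :=
  limUnder atTop (mzvTrunc t)

/-- The argument list `s, {1}_k` with no bars. -/
def plainArgs (s k : ℕ) : List (ℕ × Bool) :=
  (s, false) :: List.replicate k (1, false)

/-- The argument list `s, {1}_k` with a bar over `s` only. -/
def barArgs (s k : ℕ) : List (ℕ × Bool) :=
  (s, true) :: List.replicate k (1, false)

/-- `I n ∼ ∑_{p ≥ 0} c p / n^p` as `n → ∞`, in the sense of Poincaré. -/
def HasAsymptoticSeries (I : ℕ → ℝ) (c : ℕ → ℝ) : Prop :=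
  ∀ N : ℕ, (fun n : ℕ => I n - ∑ p ∈ Finset.range (N + 1), c p / (n : ℝ) ^ p)
    =o[atTop] fun n : ℕ => 1 / (n : ℝ) ^ N

end

noncomputable section

/-! The factor `(1 + q u^n)^(w/n) - 1` is exponentially small on `u ≤ δ < 1`, so only the behaviour
of `f` at `u = 1` matters. With `u = e^s`, the Taylor expansion of `f(e^s) e^s` at `s = 0` writes `u
f(u)` as a series in `log u` whose coefficients are `(-1)^j β_j / j!`; the Stirling numbers come
from differentiating `f(e^s) e^s` repeatedly (`iteratedDeriv_comp_exp_mul_exp`). The substitution `t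
= u^n` turns `log^j u · du/u` into `n^{-j-1} log^j t · dt/t` (`integral_log_pow_mul_comp_pow`), and
expanding `(1 + q t)^(w/n) = exp((w/n) log(1 + q t))` gives powers `(w/n)^k`, `k ≥ 1`, with Nielsen
integrals as coefficients. Collecting `p = j + 1 + k` yields `a_p`, and no term with `p = 1`
(`isBigO_mainIntegral`, `sum_expansionCoeff_div_pow`).

For `q = ±1`, the Taylor coefficients of `(-log(1 - t))^(k+1) / (k+1)!` are elementary symmetric
functions of `1, 1/2, …` divided by the index; integrating termwise turns the Nielsen integrals into
multiple zeta series (`hasSum_nielsenS`).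

For the rationality, the generating function of `S_{m,k}(1)` is a beta integral, equal to
`Γ(1+x)Γ(1+y)/Γ(1+x+y)`, whose logarithm has coefficients that are rational multiples of zeta
values. On each line `y = r x`, `r` a positive integer, exponentiating keeps the coefficients in the
algebra generated by zeta values (`betaSeriesCoeff_mem`). These coefficients are polynomials in `r`
with the `S_{m,k}(1)` as coefficients, so inverting a Vandermonde matrix isolates each of them
(`nielsenS_one_mem`). -/

/-! ### Integrability of logarithmic kernels on `(0, 1)`. -/

theorem integrableOn_beta_kernel {e a : ℝ} (he : e < 1) (ha : a < 1) :
    IntegrableOn (fun t : ℝ => t ^ (-e) * (1 - t) ^ (-a)) (Set.Ioo 0 1) := by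
  have h := Complex.betaIntegral_convergent (u := ((1 - e : ℝ) : ℂ)) (v := ((1 - a : ℝ) : ℂ))
    (by simpa using he) (by simpa using ha)
  rw [intervalIntegrable_iff_integrableOn_Ioo_of_le zero_le_one] at h
  refine (IntegrableOn.congr_fun h.norm (fun t ht => ?_) measurableSet_Ioo)
  have h1 : (0 : ℝ) < 1 - t := by linarith [ht.2]
  have e1 : (1 - (t : ℂ)) = ((1 - t : ℝ) : ℂ) := by push_cast; ring
  rw [norm_mul, e1, Complex.norm_cpow_eq_rpow_re_of_pos ht.1,
    Complex.norm_cpow_eq_rpow_re_of_pos h1]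
  congr 2 <;> simp

theorem pow_div_factorial_le_exp_sub_one {y : ℝ} (hy : 0 ≤ y) {k : ℕ} (hk : 1 ≤ k) :
    y ^ k / k.factorial ≤ Real.exp y - 1 := by
  have h := Real.sum_le_exp_of_nonneg hy (k + 1)
  have h2 : ∑ i ∈ ({0, k} : Finset ℕ), y ^ i / (i.factorial : ℝ)
      ≤ ∑ i ∈ Finset.range (k + 1), y ^ i / (i.factorial : ℝ) := by
    apply Finset.sum_le_sum_of_subset_of_nonneg
    · intro i hi; simp at hi ⊢; omega
    · intros; positivity
  rw [Finset.sum_pair (by omega)] at h2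
  simp at h2
  linarith

theorem pow_mul_le_exp {y c : ℝ} (hy : 0 ≤ y) (hc : 0 < c) (m : ℕ) :
    y ^ m ≤ m.factorial / c ^ m * Real.exp (c * y) := by
  have h := Real.pow_div_factorial_le_exp (c * y) (by positivity) m
  rw [mul_pow] at h
  have : (0:ℝ) < m.factorial := by positivity
  rw [div_le_iff₀ this] at h
  rw [div_mul_eq_mul_div, le_div_iff₀ (by positivity)]
  linarith

/-- Keeping the `-1` preserves the vanishing at `y = 0`; with `y = -log(1 - t)` this compensates the
factor `1/t` at `t = 0`. -/
theorem pow_mul_le_exp_sub_one {y c : ℝ} (hy : 0 ≤ y) (hc : 0 < c) {k : ℕ} (hk : 1 ≤ k) :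
    y ^ k ≤ k.factorial / c ^ k * (Real.exp (c * y) - 1) := by
  have h := pow_div_factorial_le_exp_sub_one (y := c * y) (by positivity) hk
  rw [mul_pow] at h
  have : (0:ℝ) < k.factorial := by positivity
  rw [div_le_iff₀ this] at h
  rw [div_mul_eq_mul_div, le_div_iff₀ (by positivity)]
  linarith

theorem exp_neg_log_mul {s a : ℝ} (hs : 0 < s) : Real.exp (a * -Real.log s) = s ^ (-a) := by
  rw [Real.rpow_def_of_pos hs]; ring_nf

/-- Equivalent to `s^(1-a) ≤ 1`. For `s = 1 - t` the factor `1 - s = t` cancels the pole `1/t`. -/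
theorem rpow_neg_sub_one_le {s a : ℝ} (hs : 0 < s) (hs1 : s ≤ 1) (ha1 : a ≤ 1) :
    s ^ (-a) - 1 ≤ (1 - s) * s ^ (-a) := by
  have h : s * s ^ (-a) ≤ 1 := by
    have := Real.rpow_add hs 1 (-a)
    rw [Real.rpow_one] at this
    rw [← this]
    exact Real.rpow_le_one hs.le hs1 (by linarith)
  nlinarith

theorem neg_log_nonneg {t : ℝ} (ht : t ∈ Set.Ioo (0 : ℝ) 1) : 0 ≤ -Real.log t := by
  have := Real.log_nonpos ht.1.le ht.2.le
  linarith

theorem one_sub_mem {t : ℝ} (ht : t ∈ Set.Ioo (0 : ℝ) 1) : 1 - t ∈ Set.Ioo (0 : ℝ) 1 :=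
  ⟨by linarith [ht.2], by linarith [ht.1]⟩

/-- The function dominating all the integrands with logarithmic factors. -/
theorem integrableOn_exp_mul_exp_sub_one {e a : ℝ} (he : e < 1) (ha0 : 0 ≤ a) (ha : a < 1) :
    IntegrableOn (fun t : ℝ => Real.exp (e * -Real.log t) *
      (Real.exp (a * -Real.log (1 - t)) - 1) / t) (Set.Ioo 0 1) := by
  refine Integrable.mono' (integrableOn_beta_kernel he ha)
    (Measurable.aestronglyMeasurable (by fun_prop)) ?_
  refine (ae_restrict_iff' measurableSet_Ioo).2 (ae_of_all _ fun t ht => ?_)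
  have h1 := one_sub_mem ht
  rw [exp_neg_log_mul ht.1, exp_neg_log_mul h1.1]
  have hp : 1 ≤ (1 - t) ^ (-a) := Real.one_le_rpow_of_pos_of_le_one_of_nonpos h1.1 h1.2.le (by linarith)
  have h2 := rpow_neg_sub_one_le h1.1 h1.2.le ha.le
  have ht0 : 0 < t ^ (-e) := Real.rpow_pos_of_pos ht.1 _
  rw [Real.norm_of_nonneg (div_nonneg (mul_nonneg ht0.le (by linarith)) ht.1.le),
    div_le_iff₀ ht.1]
  nlinarith

/-- The extra factor `exp(y/2)`, `y = -log(1 - t)`, is what the remainder of the exponential series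
costs once `2|w| ≤ n`. -/
theorem integrableOn_log_pow_mul_exp (m : ℕ) {k : ℕ} (hk : 1 ≤ k) :
    IntegrableOn (fun t : ℝ => (-Real.log t) ^ m * (-Real.log (1 - t)) ^ k *
      Real.exp (1 / 2 * -Real.log (1 - t)) / t) (Set.Ioo 0 1) := by
  -- The powers of the logarithms cost `t^(-1/2)` and `(1-t)^(-1/4)`; with the given `(1-t)^(-1/2)`
  -- the total exponent `3/4` stays below `1`.
  have hI := (integrableOn_exp_mul_exp_sub_one (e := 1 / 2) (a := 3 / 4) (by norm_num) (by norm_num)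
    (by norm_num)).const_mul (m.factorial / (1 / 2 : ℝ) ^ m * (k.factorial / (1 / 4 : ℝ) ^ k))
  refine Integrable.mono' hI (Measurable.aestronglyMeasurable (by fun_prop)) ?_
  refine (ae_restrict_iff' measurableSet_Ioo).2 (ae_of_all _ fun t ht => ?_)
  have hx := neg_log_nonneg ht
  have hy := neg_log_nonneg (one_sub_mem ht)
  set x := -Real.log t
  set y := -Real.log (1 - t)
  have b1 := pow_mul_le_exp hx (c := 1 / 2) (by norm_num) m
  have b2 := pow_mul_le_exp_sub_one hy (c := 1 / 4) (by norm_num) hk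
  have b3 : (Real.exp (1 / 4 * y) - 1) * Real.exp (1 / 2 * y) ≤ Real.exp (3 / 4 * y) - 1 := by
    have : Real.exp (3 / 4 * y) = Real.exp (1 / 4 * y) * Real.exp (1 / 2 * y) := by
      rw [← Real.exp_add]; ring_nf
    rw [this]
    have := Real.one_le_exp (show 0 ≤ 1 / 2 * y by positivity)
    linarith
  have ht0 := ht.1
  rw [Real.norm_of_nonneg (by positivity), ← mul_div_assoc]
  refine div_le_div_of_nonneg_right ?_ ht0.le
  calc x ^ m * y ^ k * Real.exp (1 / 2 * y)
      ≤ (m.factorial / (1 / 2 : ℝ) ^ m * Real.exp (1 / 2 * x)) *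
        (k.factorial / (1 / 4 : ℝ) ^ k * (Real.exp (1 / 4 * y) - 1)) * Real.exp (1 / 2 * y) := by
        gcongr
    _ = m.factorial / (1 / 2 : ℝ) ^ m * (k.factorial / (1 / 4 : ℝ) ^ k) *
        (Real.exp (1 / 2 * x) * ((Real.exp (1 / 4 * y) - 1) * Real.exp (1 / 2 * y))) := by ring
    _ ≤ _ := by gcongr

theorem integrableOn_log_pow_mul_log_pow (m : ℕ) {k : ℕ} (hk : 1 ≤ k) :
    IntegrableOn (fun t : ℝ => (-Real.log t) ^ m * (-Real.log (1 - t)) ^ k / t)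
      (Set.Ioo 0 1) := by
  refine Integrable.mono' (integrableOn_log_pow_mul_exp m hk)
    (Measurable.aestronglyMeasurable (by fun_prop)) ?_
  refine (ae_restrict_iff' measurableSet_Ioo).2 (ae_of_all _ fun t ht => ?_)
  have hx := neg_log_nonneg ht
  have hy := neg_log_nonneg (one_sub_mem ht)
  have ht0 := ht.1
  rw [Real.norm_of_nonneg (by positivity)]
  refine div_le_div_of_nonneg_right ?_ ht0.le
  exact le_mul_of_one_le_right (by positivity) (Real.one_le_exp (by positivity))

/-- From `1 - t ≤ 1 + q t ≤ 1 + t ≤ 1/(1 - t)`. It makes `q = -1` the worst case for every estimate.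
-/
theorem abs_log_one_add_mul_le {q t : ℝ} (hq : |q| ≤ 1) (ht : t ∈ Set.Ioo (0 : ℝ) 1) :
    |Real.log (1 + q * t)| ≤ -Real.log (1 - t) := by
  obtain ⟨h1, h2⟩ := abs_le.1 hq
  have h3 := one_sub_mem ht
  have l1 : 1 - t ≤ 1 + q * t := by nlinarith [ht.1]
  have l2 : 1 + q * t ≤ (1 - t)⁻¹ := by
    rw [le_inv_comm₀ (by linarith [h3.1]) h3.1]
    rw [le_inv_comm₀ h3.1 (by linarith [h3.1])]
    rw [le_inv_comm₀ (by linarith [h3.1]) h3.1, inv_eq_one_div, le_div_iff₀ (by linarith [h3.1])]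
    nlinarith [mul_le_mul_of_nonneg_right h2 (mul_pos ht.1 h3.1).le, sq_nonneg t]
  rw [abs_le]
  constructor
  · rw [neg_neg]; exact Real.log_le_log h3.1 l1
  · rw [← Real.log_inv]; exact Real.log_le_log (by linarith [h3.1]) l2

theorem integrableOn_nielsenIntegrand {q : ℝ} (hq : |q| ≤ 1) (m : ℕ) {k : ℕ} (hk : 1 ≤ k) :
    IntegrableOn (fun t : ℝ => Real.log t ^ m * Real.log (1 + q * t) ^ k / t)
      (Set.Ioo 0 1) := by
  refine Integrable.mono' (integrableOn_log_pow_mul_log_pow m hk)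
    (Measurable.aestronglyMeasurable (by fun_prop)) ?_
  refine (ae_restrict_iff' measurableSet_Ioo).2 (ae_of_all _ fun t ht => ?_)
  have hx := neg_log_nonneg ht
  have hy := neg_log_nonneg (one_sub_mem ht)
  have ht0 := ht.1
  rw [norm_div, norm_mul, norm_pow, norm_pow, Real.norm_eq_abs, Real.norm_eq_abs, Real.norm_eq_abs,
    abs_of_pos ht0, abs_of_nonpos (by linarith : Real.log t ≤ 0)]
  gcongr
  exact abs_log_one_add_mul_le hq ht

theorem intervalIntegrable_nielsenIntegrand {q : ℝ} (hq : |q| ≤ 1) (m : ℕ) {k : ℕ} (hk : 1 ≤ k) :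
    IntervalIntegrable (nielsenIntegrand m k (-q)) volume 0 1 := by
  rw [intervalIntegrable_iff_integrableOn_Ioo_of_le zero_le_one]
  refine (integrableOn_nielsenIntegrand hq (m - 1) hk).congr_fun (fun t _ => ?_) measurableSet_Ioo
  simp [nielsenIntegrand]

theorem intervalIntegrable_mainIntegrand {f : ℝ → ℝ} {q w : ℝ}
    (hint : IntervalIntegrable f volume 0 1)
    (hqw : (-1 < q ∧ q ≤ 1 ∧ w ≠ 0) ∨ (q = -1 ∧ 0 < w)) (n : ℕ) :
    IntervalIntegrable (mainIntegrand f q w n) volume 0 1 := by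
  apply IntervalIntegrable.mul_continuousOn hint
  rw [Set.uIcc_of_le zero_le_one]
  refine ContinuousOn.rpow_const (by fun_prop) fun u hu => ?_
  have h1 : u ^ n ≤ 1 := pow_le_one₀ hu.1 hu.2
  have h0 : 0 ≤ u ^ n := pow_nonneg hu.1 n
  -- For `q > -1` the base is positive on `[0, 1]`. For `q = -1` it vanishes at `u = 1`, so the
  -- exponent has to be nonnegative.
  rcases hqw with ⟨h, -, -⟩ | ⟨-, h⟩
  · left
    rcases le_total 0 q with h2 | h2 <;> nlinarith
  · right; positivity

/-! ### Expansion of the kernel `(1 + q t)^(w/n) - 1` in powers of `1/n`. -/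

theorem abs_exp_sub_sum_le (x : ℝ) (K : ℕ) :
    |Real.exp x - ∑ k ∈ Finset.range K, x ^ k / k.factorial| ≤ |x| ^ K * Real.exp |x| := by
  have h := Complex.norm_exp_sub_sum_le_norm_mul_exp (x : ℂ) K
  rw [Complex.norm_real, Real.norm_eq_abs] at h
  convert h using 1
  rw [← Real.norm_eq_abs, ← Complex.norm_real]
  push_cast
  rfl

theorem one_add_mul_pos {q t : ℝ} (hq : |q| ≤ 1) (ht : t ∈ Set.Ioo (0 : ℝ) 1) : 0 < 1 + q * t := by
  obtain ⟨h1, h2⟩ := abs_le.1 hq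
  nlinarith [ht.1, ht.2]

/-- Taylor remainder of `exp` at `(w/n) log(1 + q t)`, whose absolute value is at most `y/2` for `y
= -log(1 - t)` because `2|w| ≤ n`. The resulting majorant is independent of `n` up to the power of
`|w|/n`. -/
theorem abs_rpow_sub_one_sub_sum_le {q w t : ℝ} (hq : |q| ≤ 1) (ht : t ∈ Set.Ioo (0 : ℝ) 1)
    {n : ℕ} (hn : 0 < n) (hnw : 2 * |w| ≤ n) (K : ℕ) :
    |((1 + q * t) ^ (w / n) - 1) -
        ∑ k ∈ Finset.Icc 1 K, (w / n) ^ k / k.factorial * Real.log (1 + q * t) ^ k| ≤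
      (|w| / n) ^ (K + 1) * ((-Real.log (1 - t)) ^ (K + 1) *
        Real.exp (1 / 2 * -Real.log (1 - t))) := by
  have hn' : (0 : ℝ) < n := by exact_mod_cast hn
  have hL := abs_log_one_add_mul_le hq ht
  have hy := neg_log_nonneg (one_sub_mem ht)
  set y := -Real.log (1 - t)
  have h := abs_exp_sub_sum_le (Real.log (1 + q * t) * (w / n)) (K + 1)
  rw [← Real.rpow_def_of_pos (one_add_mul_pos hq ht), Finset.sum_range_eq_add_Ico _ (by omega),
    ← sub_sub] at h
  have e : Finset.Ico 1 (K + 1) = Finset.Icc 1 K := by ext; simp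
  rw [e] at h
  simp only [pow_zero, Nat.factorial_zero, Nat.cast_one, div_one] at h
  have e2 : ∀ k, (Real.log (1 + q * t) * (w / n)) ^ k / (k.factorial : ℝ)
      = (w / n) ^ k / k.factorial * Real.log (1 + q * t) ^ k := by
    intro k; rw [mul_pow]; ring
  simp only [e2] at h
  refine h.trans ?_
  have b1 : |Real.log (1 + q * t) * (w / n)| ≤ y * (|w| / n) := by
    rw [abs_mul, abs_div, abs_of_pos hn']
    gcongr
  have b2 : |w| / n ≤ 1 / 2 := by rw [div_le_iff₀ hn']; linarith
  have b3 : |Real.log (1 + q * t) * (w / n)| ≤ 1 / 2 * y :=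
    b1.trans (by rw [mul_comm]; exact mul_le_mul_of_nonneg_right b2 hy)
  calc _ ≤ (y * (|w| / n)) ^ (K + 1) * Real.exp (1 / 2 * y) := by gcongr
    _ = _ := by rw [mul_pow]; ring

theorem abs_rpow_sub_one_le {q w t : ℝ} (hq : |q| ≤ 1) (ht : t ∈ Set.Ioo (0 : ℝ) 1)
    {n : ℕ} (hn : 0 < n) (hnw : 2 * |w| ≤ n) :
    |(1 + q * t) ^ (w / n) - 1| ≤
      (|w| / n) * (-Real.log (1 - t) * Real.exp (1 / 2 * -Real.log (1 - t))) := by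
  simpa using abs_rpow_sub_one_sub_sum_le hq ht hn hnw 0

theorem integrableOn_log_pow_mul_rpow_sub_one {q w : ℝ} (hq : |q| ≤ 1)
    {n : ℕ} (hn : 0 < n) (hnw : 2 * |w| ≤ n) (j : ℕ) :
    IntegrableOn (fun t : ℝ => Real.log t ^ j * ((1 + q * t) ^ (w / n) - 1) / t)
      (Set.Ioo 0 1) := by
  refine Integrable.mono' ((integrableOn_log_pow_mul_exp j (le_refl 1)).const_mul (|w| / n))
    (Measurable.aestronglyMeasurable (by fun_prop)) ?_
  refine (ae_restrict_iff' measurableSet_Ioo).2 (ae_of_all _ fun t ht => ?_)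
  have hx := neg_log_nonneg ht
  rw [norm_div, norm_mul, norm_pow, Real.norm_eq_abs, Real.norm_eq_abs, Real.norm_eq_abs,
    abs_of_pos ht.1, abs_of_nonpos (by linarith : Real.log t ≤ 0), ← mul_div_assoc]
  refine div_le_div_of_nonneg_right ?_ ht.1.le
  have := mul_le_mul_of_nonneg_left (abs_rpow_sub_one_le hq ht hn hnw) (pow_nonneg hx j)
  linarith

theorem integral_abs_log_pow_mul_rpow_sub_one_le {q w : ℝ} (hq : |q| ≤ 1)
    {n : ℕ} (hn : 0 < n) (hnw : 2 * |w| ≤ n) (j : ℕ) :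
    ∫ t in Set.Ioo (0 : ℝ) 1, |Real.log t ^ j * ((1 + q * t) ^ (w / n) - 1) / t| ≤
      (|w| / n) * ∫ t in Set.Ioo (0 : ℝ) 1, (-Real.log t) ^ j * (-Real.log (1 - t)) ^ 1 *
        Real.exp (1 / 2 * -Real.log (1 - t)) / t := by
  rw [← integral_const_mul]
  refine setIntegral_mono_on (integrableOn_log_pow_mul_rpow_sub_one hq hn hnw j).abs
    ((integrableOn_log_pow_mul_exp j (le_refl 1)).const_mul (|w| / n)) measurableSet_Ioo
    fun t ht => ?_
  have hx := neg_log_nonneg ht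
  rw [abs_div, abs_mul, abs_pow,
    abs_of_pos ht.1, abs_of_nonpos (by linarith : Real.log t ≤ 0), ← mul_div_assoc]
  refine div_le_div_of_nonneg_right ?_ ht.1.le
  have := mul_le_mul_of_nonneg_left (abs_rpow_sub_one_le hq ht hn hnw) (pow_nonneg hx j)
  linarith

theorem eventually_pos_and_two_mul_le (w : ℝ) : ∀ᶠ n : ℕ in atTop, 0 < n ∧ 2 * |w| ≤ n :=
  (eventually_gt_atTop 0).and (tendsto_natCast_atTop_atTop.eventually_ge_atTop _)

theorem isBigO_integral_log_pow_mul_rpow_sub_one {q : ℝ} (w : ℝ) (hq : |q| ≤ 1) (j K : ℕ) :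
    (fun n : ℕ => (∫ t in Set.Ioo (0 : ℝ) 1, Real.log t ^ j * ((1 + q * t) ^ (w / n) - 1) / t) -
      ∑ k ∈ Finset.Icc 1 K, (w / n) ^ k / k.factorial *
        ∫ t in Set.Ioo (0 : ℝ) 1, Real.log t ^ j * Real.log (1 + q * t) ^ k / t)
      =O[atTop] fun n : ℕ => (1 / n : ℝ) ^ (K + 1) := by
  set D := ∫ t in Set.Ioo (0 : ℝ) 1, (-Real.log t) ^ j * (-Real.log (1 - t)) ^ (K + 1) *
        Real.exp (1 / 2 * -Real.log (1 - t)) / t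
  refine IsBigO.of_bound (|w| ^ (K + 1) * D) ?_
  filter_upwards [eventually_pos_and_two_mul_le w] with n ⟨hn, hnw⟩
  have hI : ∀ k ∈ Finset.Icc 1 K, Integrable (fun t => (w / n) ^ k / k.factorial *
      (Real.log t ^ j * Real.log (1 + q * t) ^ k / t)) (volume.restrict (Set.Ioo (0 : ℝ) 1)) :=
    fun k hk => (integrableOn_nielsenIntegrand hq j (Finset.mem_Icc.1 hk).1).const_mul _
  simp_rw [← integral_const_mul]
  rw [← integral_finsetSum _ hI, ← integral_sub (integrableOn_log_pow_mul_rpow_sub_one hq hn hnw j)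
    (integrable_finsetSum _ hI)]
  have hDI := (integrableOn_log_pow_mul_exp j (show 1 ≤ K + 1 by omega)).const_mul
    ((|w| / n) ^ (K + 1))
  have hb := norm_integral_le_of_norm_le hDI (f := fun t : ℝ =>
    Real.log t ^ j * ((1 + q * t) ^ (w / n) - 1) / t - ∑ k ∈ Finset.Icc 1 K,
      (w / n) ^ k / k.factorial * (Real.log t ^ j * Real.log (1 + q * t) ^ k / t)) ?_
  · refine hb.trans (le_of_eq ?_)
    rw [integral_const_mul, Real.norm_of_nonneg (by positivity), div_pow, div_pow]
    ring
  refine (ae_restrict_iff' measurableSet_Ioo).2 (ae_of_all _ fun t ht => ?_)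
  have hx := neg_log_nonneg ht
  have e : Real.log t ^ j * ((1 + q * t) ^ (w / n) - 1) / t - ∑ k ∈ Finset.Icc 1 K,
      (w / n) ^ k / k.factorial * (Real.log t ^ j * Real.log (1 + q * t) ^ k / t) =
      Real.log t ^ j * (((1 + q * t) ^ (w / n) - 1) - ∑ k ∈ Finset.Icc 1 K,
      (w / n) ^ k / k.factorial * Real.log (1 + q * t) ^ k) / t := by
    rw [mul_sub (Real.log t ^ j) (_ - 1), sub_div, Finset.mul_sum, Finset.sum_div]
    congr 1
    refine Finset.sum_congr rfl fun k _ => by ring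
  rw [e, norm_div, norm_mul, norm_pow, Real.norm_eq_abs, Real.norm_eq_abs, Real.norm_eq_abs,
    abs_of_pos ht.1, abs_of_nonpos (by linarith : Real.log t ≤ 0), ← mul_div_assoc]
  refine div_le_div_of_nonneg_right ?_ ht.1.le
  have := mul_le_mul_of_nonneg_left (abs_rpow_sub_one_sub_sum_le (w := w) hq ht hn hnw K)
    (pow_nonneg hx j)
  linarith

/-! ### The substitution `t = u^n`. -/

theorem image_pow_Ioo {n : ℕ} (hn : 0 < n) :
    (fun u : ℝ => u ^ n) '' Set.Ioo 0 1 = Set.Ioo 0 1 := by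
  ext t
  constructor
  · rintro ⟨u, hu, rfl⟩
    exact ⟨pow_pos hu.1 n, pow_lt_one₀ hu.1.le hu.2 hn.ne'⟩
  · intro ht
    have hn' : (0 : ℝ) < (n : ℝ)⁻¹ := by positivity
    exact ⟨t ^ ((n : ℝ)⁻¹), ⟨Real.rpow_pos_of_pos ht.1 _, Real.rpow_lt_one ht.1.le ht.2 hn'⟩,
      Real.rpow_inv_natCast_pow ht.1.le hn.ne'⟩

theorem pow_mem_Ioo {n : ℕ} (hn : 0 < n) {u : ℝ} (hu : u ∈ Set.Ioo (0 : ℝ) 1) :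
    u ^ n ∈ Set.Ioo (0 : ℝ) 1 := by
  rw [← image_pow_Ioo hn]; exact ⟨u, hu, rfl⟩

/-- Each `log u = (log t)/n` gives one factor `1/n`, and `du/u = dt/(n t)` gives one more. -/
theorem integral_log_pow_mul_comp_pow {n : ℕ} (hn : 0 < n) (j : ℕ) (φ : ℝ → ℝ) :
    ∫ u in Set.Ioo (0 : ℝ) 1, Real.log u ^ j * φ (u ^ n) / u =
      (1 / n : ℝ) ^ (j + 1) * ∫ t in Set.Ioo (0 : ℝ) 1, Real.log t ^ j * φ t / t := by
  have hn' : (n : ℝ) ≠ 0 := by positivity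
  have h := integral_image_eq_integral_abs_deriv_smul (s := Set.Ioo (0 : ℝ) 1) measurableSet_Ioo
    (f := fun u => u ^ n) (f' := fun u => n * u ^ (n - 1))
    (fun u _ => (hasDerivAt_pow n u).hasDerivWithinAt)
    (fun a ha b hb hab => (pow_left_inj₀ ha.1.le hb.1.le hn.ne').1 hab)
    (fun t => Real.log t ^ j * φ t / t)
  rw [image_pow_Ioo hn] at h
  rw [h, ← integral_const_mul]
  refine setIntegral_congr_fun measurableSet_Ioo fun u hu => ?_
  have hu0 := hu.1
  have hp : u ^ n = u * u ^ (n - 1) := by rw [← pow_succ', Nat.sub_add_cancel hn]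
  have hp0 : u ^ (n - 1) ≠ 0 := by positivity
  simp only [smul_eq_mul]
  rw [abs_of_nonneg (by positivity), Real.log_pow, mul_pow]
  generalize φ (u ^ n) = z
  rw [hp, pow_succ, one_div, inv_pow]
  field_simp

theorem integrableOn_log_pow_mul_comp_pow {n : ℕ} (hn : 0 < n) (j : ℕ) {φ : ℝ → ℝ}
    (h0 : IntegrableOn (fun t => Real.log t ^ j * φ t / t) (Set.Ioo 0 1)) :
    IntegrableOn (fun u => Real.log u ^ j * φ (u ^ n) / u) (Set.Ioo 0 1) := by
  have hn' : (n : ℝ) ≠ 0 := by positivity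
  have h := integrableOn_image_iff_integrableOn_abs_deriv_smul (s := Set.Ioo (0 : ℝ) 1)
    measurableSet_Ioo
    (f := fun u => u ^ n) (f' := fun u => n * u ^ (n - 1))
    (fun u _ => (hasDerivAt_pow n u).hasDerivWithinAt)
    (fun a ha b hb hab => (pow_left_inj₀ ha.1.le hb.1.le hn.ne').1 hab)
    (fun t => Real.log t ^ j * φ t / t)
  rw [image_pow_Ioo hn] at h
  refine IntegrableOn.congr_fun ((h.1 h0).const_mul ((1 / n : ℝ) ^ (j + 1))) (fun u hu => ?_)
    measurableSet_Ioo
  have hu0 := hu.1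
  have hp : u ^ n = u * u ^ (n - 1) := by rw [← pow_succ', Nat.sub_add_cancel hn]
  have hp0 : u ^ (n - 1) ≠ 0 := by positivity
  simp only [smul_eq_mul]
  rw [abs_of_nonneg (by positivity), Real.log_pow, mul_pow]
  generalize φ (u ^ n) = z
  rw [hp, pow_succ, one_div, inv_pow]
  field_simp

/-! ### Taylor expansion of `u f(u)` in powers of `log u`. -/

/-- The derivatives of `s ↦ f (exp s) exp s`. -/
theorem iteratedDeriv_comp_exp_mul_exp {f : ℝ → ℝ} (hf : AnalyticAt ℝ f 1) (j : ℕ) :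
    ∀ᶠ s in 𝓝 (0 : ℝ), iteratedDeriv j (fun s => f (Real.exp s) * Real.exp s) s =
      ∑ l ∈ Finset.range (j + 1), (Nat.stirlingSecond (j + 1) (l + 1) : ℝ) *
        (iteratedDeriv l f (Real.exp s) * Real.exp s ^ (l + 1)) := by
  have hev : ∀ᶠ s in 𝓝 (0 : ℝ), AnalyticAt ℝ f (Real.exp s) := by
    have h1 : Tendsto Real.exp (𝓝 0) (𝓝 1) := by
      simpa using Real.continuous_exp.tendsto 0
    exact h1.eventually hf.eventually_analyticAt
  induction j with
  | zero => simp [Nat.stirlingSecond_self]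
  | succ j ih =>
    -- The inductive formula holds on a neighbourhood of `s`, hence may be differentiated at `s`.
    filter_upwards [eventually_eventually_nhds.2 ih, hev] with s hs ha
    rw [iteratedDeriv_succ, EventuallyEq.deriv_eq hs]
    have hd : ∀ l, HasDerivAt (fun s => iteratedDeriv l f (Real.exp s) * Real.exp s ^ (l + 1))
        (iteratedDeriv (l + 1) f (Real.exp s) * Real.exp s ^ (l + 2) +
          (l + 1) * (iteratedDeriv l f (Real.exp s) * Real.exp s ^ (l + 1))) s := by
      intro l
      have h1 : HasDerivAt (iteratedDeriv l f) (iteratedDeriv (l + 1) f (Real.exp s))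
          (Real.exp s) := by
        rw [iteratedDeriv_succ]
        rw [iteratedDeriv_eq_iterate]
        exact (ha.iterated_deriv l).differentiableAt.hasDerivAt
      have h2 := (h1.comp s (Real.hasDerivAt_exp s)).mul ((Real.hasDerivAt_exp s).pow (l + 1))
      refine HasDerivAt.congr_deriv h2 ?_
      simp only [Function.comp, Nat.add_sub_cancel, Nat.cast_add, Nat.cast_one, Pi.pow_apply]
      ring
    have hsum := HasDerivAt.fun_sum (u := Finset.range (j + 1)) fun l _ =>
      (hd l).const_mul (Nat.stirlingSecond (j + 1) (l + 1) : ℝ)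
    rw [hsum.deriv]
    set a : ℕ → ℝ := fun l => iteratedDeriv l f (Real.exp s) * Real.exp s ^ (l + 1)
    have e : ∀ l, (Nat.stirlingSecond (j + 1 + 1) (l + 1) : ℝ) =
        (l + 1) * Nat.stirlingSecond (j + 1) (l + 1) + Nat.stirlingSecond (j + 1) l := by
      intro l; rw [Nat.stirlingSecond_succ_succ]; push_cast; ring
    change ∑ l ∈ Finset.range (j + 1), (Nat.stirlingSecond (j + 1) (l + 1) : ℝ) *
      (a (l + 1) + (l + 1) * a l) = ∑ l ∈ Finset.range (j + 1 + 1),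
        (Nat.stirlingSecond (j + 1 + 1) (l + 1) : ℝ) * a l
    have e1 : ∀ l ∈ Finset.range (j + 1), (Nat.stirlingSecond (j + 1) (l + 1) : ℝ) *
        (a (l + 1) + (l + 1) * a l) = (Nat.stirlingSecond (j + 1) (l + 1) : ℝ) * a (l + 1) +
        ((l + 1) * Nat.stirlingSecond (j + 1) (l + 1) : ℝ) * a l := fun l _ => by ring
    have e2 : ∀ l ∈ Finset.range (j + 1 + 1), (Nat.stirlingSecond (j + 1 + 1) (l + 1) : ℝ) * a l =
        (Nat.stirlingSecond (j + 1) l : ℝ) * a l +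
        ((l + 1) * Nat.stirlingSecond (j + 1) (l + 1) : ℝ) * a l := fun l _ => by rw [e]; ring
    -- The Stirling recurrence matches the two sides after shifting an index; the boundary terms
    -- vanish because `{j+1 over 0}` and `{j+1 over j+2}` are zero.
    rw [Finset.sum_congr rfl e1, Finset.sum_congr rfl e2, Finset.sum_add_distrib,
      Finset.sum_add_distrib,
      Finset.sum_range_succ' (fun l => (Nat.stirlingSecond (j + 1) l : ℝ) * a l),
      Finset.sum_range_succ (fun l => ((l + 1) * Nat.stirlingSecond (j + 1) (l + 1) : ℝ) * a l)
        (j + 1), Nat.stirlingSecond_eq_zero_of_lt (show j + 1 < j + 1 + 1 by omega)]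
    simp

/-- Taylor's formula for `f(e^s) e^s` at `s = 0`, read at `s = log u`. The factor `u` is there
because the substitution uses the measure `du/u`. -/
theorem isBigO_mul_sub_log_polynomial {f : ℝ → ℝ} (hf : AnalyticAt ℝ f 1) (N : ℕ) :
    (fun u : ℝ => u * f u - ∑ j ∈ Finset.range N,
      ((-1) ^ j * betaCoeff f j) / j.factorial * Real.log u ^ j)
      =O[𝓝 1] fun u => Real.log u ^ N := by
  have hg : AnalyticAt ℝ (fun s => f (Real.exp s) * Real.exp s) 0 := by
    refine AnalyticAt.mul (AnalyticAt.fun_comp (by simpa using hf) ?_) ?_ <;> fun_prop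
  have hps := hg.hasFPowerSeriesAt
  have hO := hps.isBigO_sub_partialSum_pow N
  simp only [zero_add] at hO
  have hlog : Tendsto Real.log (𝓝 1) (𝓝 0) := by
    simpa using (Real.continuousAt_log one_ne_zero).tendsto
  have hO2 := hO.comp_tendsto hlog
  refine (hO2.congr' ?_ ?_).trans (isBigO_refl _ _ |>.norm_left)
  · filter_upwards [eventually_gt_nhds zero_lt_one] with u hu
    simp only [Function.comp, Real.exp_log hu]
    rw [mul_comm u]
    congr 1
    rw [FormalMultilinearSeries.partialSum]
    refine Finset.sum_congr rfl fun j _ => ?_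
    have hb := (iteratedDeriv_comp_exp_mul_exp hf j).self_of_nhds
    simp only [Real.exp_zero, one_pow, mul_one] at hb
    simp [hb, betaCoeff, ← mul_assoc, ← mul_pow]
    ring
  · filter_upwards with u
    simp

/-- The Taylor coefficients at `0` of `s ↦ f (exp s) exp s`. -/
def logTaylorCoeff (f : ℝ → ℝ) (j : ℕ) : ℝ :=
  ((-1) ^ j * betaCoeff f j) / j.factorial

/-- Extends the local estimate to all of `(0, 1)`. Below `δ` nothing is known of `f` pointwise, so
`|f|` itself stays in the bound, while the polynomial is absorbed into `|log u|^N`. -/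
theorem exists_abs_mul_sub_log_polynomial_le {f : ℝ → ℝ} (hf : AnalyticAt ℝ f 1) (N : ℕ) :
    ∃ δ ∈ Set.Ioo (0 : ℝ) 1, ∃ C : ℝ, 0 ≤ C ∧ ∀ u ∈ Set.Ioo (0 : ℝ) 1,
      |f u - (∑ j ∈ Finset.range N, logTaylorCoeff f j * Real.log u ^ j) / u| ≤
        C * |Real.log u| ^ N / u + if u < δ then |f u| else 0 := by
  obtain ⟨C₁, hC₁⟩ := (isBigO_mul_sub_log_polynomial hf N).bound
  obtain ⟨r, hr, hb⟩ := Metric.eventually_nhds_iff.1 hC₁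
  -- `1 - r/2` puts `[δ, 1)` inside the ball of radius `r` about `1`; the `1/2` keeps `δ` positive.
  set δ : ℝ := max (1 / 2) (1 - r / 2)
  have hδ0 : 0 < δ := lt_max_of_lt_left (by norm_num)
  have hδ1 : δ < 1 := max_lt (by norm_num) (by linarith)
  have hδr : 1 - r / 2 ≤ δ := le_max_right _ _
  set d := |Real.log δ|
  have hd : 0 < d := abs_pos.2 (Real.log_neg hδ0 hδ1).ne
  -- For `u < δ` one has `|log u| ≥ d`, so `|log u|^j ≤ |log u|^N / d^(N-j)`.
  set C₂ := ∑ j ∈ Finset.range N, |logTaylorCoeff f j| / d ^ (N - j)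
  have hC₂ : 0 ≤ C₂ := Finset.sum_nonneg fun j _ => by positivity
  refine ⟨δ, ⟨hδ0, hδ1⟩, |C₁| + C₂, by positivity, fun u hu => ?_⟩
  have hu0 := hu.1
  split_ifs with hlt
  · have hdu : d ≤ |Real.log u| := by
      rw [show d = -Real.log δ from abs_of_neg (Real.log_neg hδ0 hδ1),
        abs_of_neg (Real.log_neg hu.1 hu.2)]
      exact neg_le_neg (Real.log_le_log hu0 hlt.le)
    have hP : |∑ j ∈ Finset.range N, logTaylorCoeff f j * Real.log u ^ j| ≤
        C₂ * |Real.log u| ^ N := by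
      refine (Finset.abs_sum_le_sum_abs _ _).trans ?_
      rw [Finset.sum_mul]
      refine Finset.sum_le_sum fun j hj => ?_
      rw [abs_mul, abs_pow, div_mul_eq_mul_div, le_div_iff₀ (by positivity), mul_assoc]
      refine mul_le_mul_of_nonneg_left ?_ (abs_nonneg _)
      calc |Real.log u| ^ j * d ^ (N - j) ≤ |Real.log u| ^ j * |Real.log u| ^ (N - j) := by gcongr
        _ = |Real.log u| ^ N := by
          rw [← pow_add, Nat.add_sub_cancel' (Finset.mem_range.1 hj).le]
    refine (abs_sub _ _).trans ?_
    rw [add_comm]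
    gcongr
    rw [abs_div, abs_of_pos hu0]
    gcongr
    refine hP.trans ?_
    gcongr
    linarith [abs_nonneg C₁]
  · have h := hb (y := u) (by
      rw [Real.dist_eq, abs_sub_comm, abs_of_pos (by linarith [hu.2])]
      linarith)
    rw [add_zero, le_div_iff₀ hu0]
    have e : |f u - (∑ j ∈ Finset.range N, logTaylorCoeff f j * Real.log u ^ j) / u| * u =
        |u * f u - ∑ j ∈ Finset.range N, logTaylorCoeff f j * Real.log u ^ j| := by
      conv_lhs => rhs; rw [← abs_of_pos hu0]
      rw [← abs_mul, sub_mul, div_mul_cancel₀ _ hu0.ne', mul_comm (f u)]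
    rw [e]
    rw [Real.norm_eq_abs, Real.norm_eq_abs, abs_pow] at h
    refine h.trans ?_
    gcongr
    linarith [le_abs_self C₁]

/-- Here `u^n ≤ δ^n ≤ δ`, and `-log(1 - s) ≤ s/(1 - s)` makes the kernel of size `δ^n`. -/
theorem exists_abs_rpow_sub_one_comp_pow_le {q : ℝ} (w : ℝ) (hq : |q| ≤ 1) {δ : ℝ}
    (hδ : δ ∈ Set.Ioo (0 : ℝ) 1) :
    ∃ C : ℝ, 0 ≤ C ∧ ∀ n : ℕ, 0 < n → 2 * |w| ≤ n → ∀ u ∈ Set.Ioo (0 : ℝ) δ,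
      |(1 + q * u ^ n) ^ (w / n) - 1| ≤ C * δ ^ n := by
  have h1δ := one_sub_mem hδ
  set M := Real.exp (1 / 2 * -Real.log (1 - δ))
  refine ⟨1 / 2 * ((1 - δ)⁻¹ * M), mul_nonneg (by norm_num) (mul_nonneg (inv_nonneg.2 h1δ.1.le)
    (Real.exp_pos _).le), fun n hn hnw u hu => ?_⟩
  have hn' : (0 : ℝ) < n := by exact_mod_cast hn
  have hu1 : u ∈ Set.Ioo (0 : ℝ) 1 := ⟨hu.1, hu.2.trans hδ.2⟩
  have ht := pow_mem_Ioo hn hu1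
  have htn : u ^ n ≤ δ ^ n := pow_le_pow_left₀ hu.1.le hu.2.le n
  have hδn : δ ^ n ≤ δ := pow_le_of_le_one hδ.1.le hδ.2.le hn.ne'
  have h1t := one_sub_mem ht
  have hL0 := neg_log_nonneg h1t
  have hL : -Real.log (1 - u ^ n) ≤ (1 - δ)⁻¹ * δ ^ n := by
    rw [← Real.log_inv]
    refine (Real.log_le_sub_one_of_pos (inv_pos.2 h1t.1)).trans ?_
    have e : (1 - u ^ n)⁻¹ - 1 = (1 - u ^ n)⁻¹ * u ^ n := by
      have := h1t.1.ne'
      field_simp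
      ring
    rw [e]
    exact mul_le_mul (inv_anti₀ h1δ.1 (by linarith)) htn ht.1.le (inv_nonneg.2 h1δ.1.le)
  have hM : Real.exp (1 / 2 * -Real.log (1 - u ^ n)) ≤ M := by
    refine Real.exp_le_exp.2 (mul_le_mul_of_nonneg_left (neg_le_neg ?_) (by norm_num))
    exact Real.log_le_log h1δ.1 (by linarith)
  have hw2 : |w| / n ≤ 1 / 2 := by rw [div_le_iff₀ hn']; linarith
  refine (abs_rpow_sub_one_le hq ht hn hnw).trans ?_
  have h0 : 0 ≤ (1 - δ)⁻¹ * δ ^ n := hL0.trans hL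
  calc _ ≤ 1 / 2 * ((1 - δ)⁻¹ * δ ^ n * M) := by gcongr
    _ = _ := by ring

/-! ### The remainder estimate and the full expansion. -/

theorem integrableOn_mul_rpow_comp_pow_sub_one {f : ℝ → ℝ} {q w : ℝ}
    (hint : IntervalIntegrable f volume 0 1)
    (hqw : (-1 < q ∧ q ≤ 1 ∧ w ≠ 0) ∨ (q = -1 ∧ 0 < w)) (n : ℕ) :
    IntegrableOn (fun u => f u * ((1 + q * u ^ n) ^ (w / n) - 1)) (Set.Ioo 0 1) := by
  rw [← intervalIntegrable_iff_integrableOn_Ioo_of_le zero_le_one]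
  refine ((intervalIntegrable_mainIntegrand hint hqw n).sub hint).congr (fun u _ => ?_)
  simp only [mainIntegrand]
  ring

/-- The part bounded by `|log u|^N / u` gains `n^{-N-1}` from the substitution; the part bounded by
`|f|` on `u < δ` is `O(δ^n)` because `f` is integrable. -/
theorem isBigO_integral_taylor_remainder {f : ℝ → ℝ} {q w : ℝ} (hf : AnalyticAt ℝ f 1)
    (hint : IntervalIntegrable f volume 0 1) (hq : |q| ≤ 1) (N : ℕ) :
    (fun n : ℕ => ∫ u in Set.Ioo (0 : ℝ) 1,
      (f u - (∑ j ∈ Finset.range N, logTaylorCoeff f j * Real.log u ^ j) / u) *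
        ((1 + q * u ^ n) ^ (w / n) - 1)) =O[atTop] fun n : ℕ => (1 / n : ℝ) ^ (N + 1) := by
  obtain ⟨δ, hδ, C, hC, hb⟩ := exists_abs_mul_sub_log_polynomial_le hf N
  obtain ⟨C', hC', hb'⟩ := exists_abs_rpow_sub_one_comp_pow_le w hq hδ
  set D := ∫ t in Set.Ioo (0 : ℝ) 1, (-Real.log t) ^ N * (-Real.log (1 - t)) ^ 1 *
        Real.exp (1 / 2 * -Real.log (1 - t)) / t
  have hfI := hint
  rw [intervalIntegrable_iff_integrableOn_Ioo_of_le zero_le_one] at hfI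
  set F := ∫ u in Set.Ioo (0 : ℝ) 1, |f u|
  have hmain : ∀ᶠ n : ℕ in atTop, ‖∫ u in Set.Ioo (0 : ℝ) 1,
      (f u - (∑ j ∈ Finset.range N, logTaylorCoeff f j * Real.log u ^ j) / u) *
        ((1 + q * u ^ n) ^ (w / n) - 1)‖ ≤
      C * ((1 / n : ℝ) ^ (N + 1) * (1 / 2 * D)) + C' * δ ^ n * F := by
    filter_upwards [eventually_pos_and_two_mul_le w] with n ⟨hn, hnw⟩
    have hn' : (0 : ℝ) < n := by exact_mod_cast hn
    have hI1 := integrableOn_log_pow_mul_comp_pow hn N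
      (φ := fun t => (1 + q * t) ^ (w / n) - 1) (integrableOn_log_pow_mul_rpow_sub_one hq hn hnw N)
    have hI2 := (hI1.abs.const_mul C).add (hfI.abs.const_mul (C' * δ ^ n))
    refine (norm_integral_le_of_norm_le hI2 ?_).trans ?_
    · refine (ae_restrict_iff' measurableSet_Ioo).2 (ae_of_all _ fun u hu => ?_)
      have hu0 := hu.1
      simp only [Pi.add_apply]
      rw [norm_mul, Real.norm_eq_abs, Real.norm_eq_abs, abs_div, abs_mul, abs_pow, abs_of_pos hu0]
      refine (mul_le_mul_of_nonneg_right (hb u hu) (abs_nonneg _)).trans ?_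
      rw [add_mul]
      refine add_le_add (le_of_eq (by ring)) ?_
      split_ifs with hlt
      · rw [mul_comm]
        exact mul_le_mul_of_nonneg_right (hb' n hn hnw u ⟨hu0, hlt⟩) (abs_nonneg _)
      · rw [zero_mul]
        have := hδ.1
        positivity
    · simp only [Pi.add_apply]
      rw [integral_add (hI1.abs.const_mul C) (hfI.abs.const_mul (C' * δ ^ n)), integral_const_mul,
        integral_const_mul]
      refine add_le_add (mul_le_mul_of_nonneg_left ?_ hC) (le_refl _)
      -- Since `log t < 0`, the absolute value of the power is `(-1)^N log^N t`; this restores the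
      -- form required by the substitution.
      have e : ∀ v : ℝ → ℝ, ∀ t ∈ Set.Ioo (0 : ℝ) 1, |Real.log t ^ N * v t / t| =
          Real.log t ^ N * ((-1) ^ N * |v t|) / t := by
        intro v t ht
        have hx := neg_log_nonneg ht
        rw [abs_div, abs_mul, abs_pow, abs_of_pos ht.1,
          abs_of_nonpos (by linarith : Real.log t ≤ 0), neg_pow]
        ring
      rw [setIntegral_congr_fun measurableSet_Ioo
          (e (fun u => (1 + q * u ^ n) ^ (w / n) - 1)),
        integral_log_pow_mul_comp_pow hn N (fun t => (-1) ^ N * |(1 + q * t) ^ (w / n) - 1|),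
        ← setIntegral_congr_fun measurableSet_Ioo (e (fun t => (1 + q * t) ^ (w / n) - 1))]
      refine mul_le_mul_of_nonneg_left ?_ (by positivity)
      refine (integral_abs_log_pow_mul_rpow_sub_one_le hq hn hnw N).trans ?_
      -- The factor `|w|/n` would give one more order; boundedness suffices.
      have hw2 : |w| / n ≤ 1 / 2 := by rw [div_le_iff₀ hn']; linarith
      refine mul_le_mul_of_nonneg_right hw2 ?_
      refine setIntegral_nonneg measurableSet_Ioo fun t ht => ?_
      have hx := neg_log_nonneg ht
      have hy := neg_log_nonneg (one_sub_mem ht)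
      have := ht.1
      positivity
  refine (IsBigO.of_bound' (hmain.mono fun n hn => hn.trans (Real.le_norm_self _))).trans ?_
  refine IsBigO.add ?_ ?_
  · refine (isBigO_refl (fun n : ℕ => (1 / n : ℝ) ^ (N + 1)) atTop).const_mul_left
      (C * (1 / 2 * D)) |>.congr_left fun n => by ring
  · have h1 : (fun n : ℕ => δ ^ n) =O[atTop] fun n : ℕ => (1 / n : ℝ) ^ (N + 1) := by
      have h2 := tendsto_pow_const_mul_const_pow_of_abs_lt_one (N + 1)
        (show |δ| < 1 by rw [abs_of_pos hδ.1]; exact hδ.2)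
      have h3 := h2.isBigO_one ℝ
      have h4 := (isBigO_refl (fun n : ℕ => (1 / n : ℝ) ^ (N + 1)) atTop).mul h3
      refine (h4.congr' ?_ (by simp))
      filter_upwards [eventually_gt_atTop 0] with n hn
      have hn' : (0 : ℝ) < n := by exact_mod_cast hn
      rw [← mul_assoc, ← mul_pow]
      field_simp
      simp
    exact (h1.const_mul_left (C' * F)).congr_left fun n => by ring

theorem isBigO_mainIntegral {f : ℝ → ℝ} {q w : ℝ} (hf : AnalyticAt ℝ f 1)
    (hint : IntervalIntegrable f volume 0 1) (hq : |q| ≤ 1)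
    (hqw : (-1 < q ∧ q ≤ 1 ∧ w ≠ 0) ∨ (q = -1 ∧ 0 < w)) (N : ℕ) :
    (fun n : ℕ => mainIntegral f q w n - (∫ u in (0 : ℝ)..1, f u) -
      ∑ j ∈ Finset.range N, logTaylorCoeff f j * ((1 / n : ℝ) ^ (j + 1) *
        ∑ k ∈ Finset.Icc 1 (N - 1 - j), (w / n) ^ k / k.factorial *
          ∫ t in Set.Ioo (0 : ℝ) 1, Real.log t ^ j * Real.log (1 + q * t) ^ k / t))
      =O[atTop] fun n : ℕ => (1 / n : ℝ) ^ (N + 1) := by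
  have h1 := isBigO_integral_taylor_remainder (w := w) hf hint hq N
  have h2 : (fun n : ℕ => ∑ j ∈ Finset.range N, logTaylorCoeff f j * ((1 / n : ℝ) ^ (j + 1) *
      ((∫ t in Set.Ioo (0 : ℝ) 1, Real.log t ^ j * ((1 + q * t) ^ (w / n) - 1) / t) -
        ∑ k ∈ Finset.Icc 1 (N - 1 - j), (w / n) ^ k / k.factorial *
          ∫ t in Set.Ioo (0 : ℝ) 1, Real.log t ^ j * Real.log (1 + q * t) ^ k / t)))
      =O[atTop] fun n : ℕ => (1 / n : ℝ) ^ (N + 1) := by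
    refine IsBigO.fun_sum fun j hj => IsBigO.const_mul_left ?_ _
    -- Truncating the inner series at `K = N - 1 - j` makes the total order `(j + 1) + (K + 1) = N +
    -- 1`.
    have h3 := (isBigO_refl (fun n : ℕ => (1 / n : ℝ) ^ (j + 1)) atTop).mul
      (isBigO_integral_log_pow_mul_rpow_sub_one w hq j (N - 1 - j))
    refine h3.congr_right fun n => ?_
    have := Finset.mem_range.1 hj
    rw [← pow_add]
    congr 1
    omega
  refine (h1.add h2).congr' ?_ EventuallyEq.rfl
  filter_upwards [eventually_pos_and_two_mul_le w] with n ⟨hn, hnw⟩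
  have hfE := integrableOn_mul_rpow_comp_pow_sub_one hint hqw n
  have hI : ∀ j ∈ Finset.range N, IntegrableOn (fun u => logTaylorCoeff f j *
      (Real.log u ^ j * ((1 + q * u ^ n) ^ (w / n) - 1) / u)) (Set.Ioo 0 1) := fun j _ =>
    (integrableOn_log_pow_mul_comp_pow hn j (φ := fun t => (1 + q * t) ^ (w / n) - 1)
      (integrableOn_log_pow_mul_rpow_sub_one hq hn hnw j)).const_mul _
  have e1 : ∀ u ∈ Set.Ioo (0 : ℝ) 1,
      (f u - (∑ j ∈ Finset.range N, logTaylorCoeff f j * Real.log u ^ j) / u) *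
        ((1 + q * u ^ n) ^ (w / n) - 1) = f u * ((1 + q * u ^ n) ^ (w / n) - 1) -
      ∑ j ∈ Finset.range N, logTaylorCoeff f j *
        (Real.log u ^ j * ((1 + q * u ^ n) ^ (w / n) - 1) / u) := by
    intro u _
    rw [sub_mul, Finset.sum_div, Finset.sum_mul]
    congr 1
    exact Finset.sum_congr rfl fun j _ => by ring
  have e2 : mainIntegral f q w n - ∫ u in (0 : ℝ)..1, f u =
      ∫ u in Set.Ioo (0 : ℝ) 1, f u * ((1 + q * u ^ n) ^ (w / n) - 1) := by
    rw [mainIntegral, ← intervalIntegral.integral_sub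
      (intervalIntegrable_mainIntegrand hint hqw n) hint,
      intervalIntegral.integral_of_le zero_le_one, integral_Ioc_eq_integral_Ioo]
    refine setIntegral_congr_fun measurableSet_Ioo fun u _ => ?_
    simp only [mainIntegrand]
    ring
  rw [e2, setIntegral_congr_fun measurableSet_Ioo e1, integral_sub hfE (integrable_finsetSum _ hI),
    integral_finsetSum _ hI]
  simp_rw [integral_const_mul]
  have e3 : ∀ j, ∫ u in Set.Ioo (0 : ℝ) 1, Real.log u ^ j * ((1 + q * u ^ n) ^ (w / n) - 1) / u =
      (1 / n : ℝ) ^ (j + 1) *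
        ∫ t in Set.Ioo (0 : ℝ) 1, Real.log t ^ j * ((1 + q * t) ^ (w / n) - 1) / t := fun j =>
    integral_log_pow_mul_comp_pow hn j fun t => (1 + q * t) ^ (w / n) - 1
  simp_rw [e3, mul_sub, Finset.sum_sub_distrib]
  ring

theorem nielsenS_neg_eq (m k : ℕ) (q : ℝ) :
    nielsenS m k (-q) = (-1) ^ (m + k - 1) / ((m - 1).factorial * k.factorial) *
      ∫ t in Set.Ioo (0 : ℝ) 1, Real.log t ^ (m - 1) * Real.log (1 + q * t) ^ k / t := by
  rw [nielsenS, intervalIntegral.integral_of_le zero_le_one, integral_Ioc_eq_integral_Ioo]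
  simp [nielsenIntegrand]

theorem sum_expansionCoeff_div_pow (f : ℝ → ℝ) (q w : ℝ) (N n : ℕ) :
    ∑ p ∈ Finset.Icc 2 N, expansionCoeff f q w p / (n : ℝ) ^ p =
      ∑ j ∈ Finset.range N, logTaylorCoeff f j * ((1 / n : ℝ) ^ (j + 1) *
        ∑ k ∈ Finset.Icc 1 (N - 1 - j), (w / n) ^ k / k.factorial *
          ∫ t in Set.Ioo (0 : ℝ) 1, Real.log t ^ j * Real.log (1 + q * t) ^ k / t) := by
  simp_rw [expansionCoeff, Finset.sum_div, Finset.mul_sum]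
  rw [Finset.sum_sigma', Finset.sum_sigma']
  -- The reindexing is `l = j + 1`, `p = j + 1 + k`.
  refine Finset.sum_bij' (fun x _ => ⟨x.2 - 1, x.1 - x.2⟩) (fun y _ => ⟨y.1 + 1 + y.2, y.1 + 1⟩)
    ?_ ?_ ?_ ?_ ?_
  · rintro ⟨p, l⟩ h
    simp only [Finset.mem_sigma, Finset.mem_Icc, Finset.mem_range] at h ⊢
    omega
  · rintro ⟨j, k⟩ h
    simp only [Finset.mem_sigma, Finset.mem_Icc, Finset.mem_range] at h ⊢
    omega
  · rintro ⟨p, l⟩ h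
    simp only [Finset.mem_sigma, Finset.mem_Icc] at h
    simp only [Sigma.mk.injEq, heq_eq_eq]
    omega
  · rintro ⟨j, k⟩ h
    simp only [Sigma.mk.injEq, heq_eq_eq]
    omega
  · rintro ⟨p, l⟩ h
    simp only [Finset.mem_sigma, Finset.mem_Icc] at h
    obtain ⟨j, rfl⟩ : ∃ j, l = j + 1 := ⟨l - 1, by omega⟩
    obtain ⟨k, rfl⟩ : ∃ k, p = j + 1 + k := ⟨p - (j + 1), by omega⟩
    have e1 : j + 1 + k - (j + 1) = k := by omega
    have e2 : j + 1 + k - 1 = j + k := by omega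
    simp only [e1, Nat.add_sub_cancel, nielsenS_neg_eq, e2, logTaylorCoeff]
    -- The sign of Nielsen's normalisation turns `(-w)^k` into `w^k (-1)^j`, and `(-1)^j` is the
    -- sign in `logTaylorCoeff`.
    have hs : (-w) ^ k * (-1) ^ (j + k) = w ^ k * (-1) ^ j := by
      rw [neg_pow, pow_add]
      have : ((-1 : ℝ)) ^ k * (-1) ^ k = 1 := by rw [← mul_pow]; simp
      linear_combination w ^ k * (-1) ^ j * this
    rw [div_pow w, one_div, inv_pow, pow_add (n : ℝ)]
    generalize (∫ t in Set.Ioo (0 : ℝ) 1, Real.log t ^ j * Real.log (1 + q * t) ^ k / t) = J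
    rw [div_eq_mul_inv _ ((n : ℝ) ^ (j + 1) * (n : ℝ) ^ k), mul_inv]
    generalize ((n : ℝ) ^ (j + 1))⁻¹ = A
    rw [div_eq_mul_inv _ ((n : ℝ) ^ k)]
    generalize ((n : ℝ) ^ k)⁻¹ = B
    rw [div_eq_mul_inv _ (_ * _), mul_inv, div_eq_mul_inv, div_eq_mul_inv]
    linear_combination betaCoeff f j * J * A * B * ((j.factorial : ℝ)⁻¹ * (k.factorial : ℝ)⁻¹) * hs

theorem hasAsymptoticSeries_mainIntegral {f : ℝ → ℝ} {q w : ℝ} (hf : AnalyticAt ℝ f 1)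
    (hint : IntervalIntegrable f volume 0 1) (hq : |q| ≤ 1)
    (hqw : (-1 < q ∧ q ≤ 1 ∧ w ≠ 0) ∨ (q = -1 ∧ 0 < w)) :
    HasAsymptoticSeries (mainIntegral f q w) (fun p =>
      if p = 0 then ∫ u in (0 : ℝ)..1, f u
      else if p = 1 then 0
      else expansionCoeff f q w p) := by
  intro N
  have h := isBigO_mainIntegral hf hint hq hqw N
  simp_rw [← sum_expansionCoeff_div_pow] at h
  have hs : ∀ n : ℕ, ∑ p ∈ Finset.range (N + 1), (if p = 0 then ∫ u in (0 : ℝ)..1, f u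
      else if p = 1 then 0 else expansionCoeff f q w p) / (n : ℝ) ^ p =
      (∫ u in (0 : ℝ)..1, f u) + ∑ p ∈ Finset.Icc 2 N, expansionCoeff f q w p / (n : ℝ) ^ p := by
    intro n
    rw [Finset.sum_range_succ']
    simp only [add_eq_zero, one_ne_zero, and_false, if_false, if_true, pow_zero, div_one]
    rw [add_comm]
    congr 1
    have e : Finset.Icc 2 N ⊆ Finset.Ico 1 (N + 1) := fun x hx => by
      simp at hx ⊢; omega
    rw [Finset.sum_subset_zero_on_sdiff (g := fun p => (if p = 1 then 0 else
      expansionCoeff f q w p) / (n : ℝ) ^ p) e]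
    · rw [Finset.sum_Ico_eq_sum_range]
      simp [add_comm]
    · intro x hx
      have : x = 1 := by simp at hx; omega
      simp [this]
    · intro x hx
      have : x ≠ 1 := by simp at hx; omega
      simp [this]
  simp_rw [hs, ← sub_sub]
  refine h.trans_isLittleO ?_
  refine IsLittleO.congr_right (?_ : _ =o[atTop] fun n : ℕ => (1 / n : ℝ) ^ N) fun n => by simp
  have h0 : Tendsto (fun n : ℕ => (1 / n : ℝ)) atTop (𝓝 0) := tendsto_one_div_atTop_nhds_zero_nat
  have := (isBigO_refl (fun n : ℕ => (1 / n : ℝ) ^ N) atTop).mul_isLittleO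
    ((isLittleO_one_iff ℝ).2 h0)
  simpa [pow_succ] using this

/-! ### Nielsen polylogarithms as multiple zeta series. -/

theorem mzvTrunc_cons (s : ℕ) (b : Bool) (t : List (ℕ × Bool)) (N : ℕ) :
    mzvTrunc ((s, b) :: t) N = ∑ n ∈ Finset.range N,
      (if b then (-1 : ℝ) ^ (n + 1) else 1) / ((n : ℝ) + 1) ^ s * mzvTrunc t n := by
  rw [mzvTrunc, show Finset.Icc 1 N = Finset.Ico 1 (N + 1) by ext; simp,
    Finset.sum_Ico_eq_sum_range]
  simp [add_comm]

/-- The elementary symmetric function of degree `k` of `1, 1/2, …, 1/N`. -/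
def harmonicSymm (k N : ℕ) : ℝ := mzvTrunc (List.replicate k (1, false)) N

theorem harmonicSymm_zero (N : ℕ) : harmonicSymm 0 N = 1 := by
  simp [harmonicSymm, mzvTrunc]

theorem harmonicSymm_succ (k N : ℕ) :
    harmonicSymm (k + 1) N = ∑ n ∈ Finset.range N, harmonicSymm k n / ((n : ℝ) + 1) := by
  rw [harmonicSymm, List.replicate_succ, mzvTrunc_cons]
  refine Finset.sum_congr rfl fun n _ => ?_
  simp [harmonicSymm]
  ring

theorem harmonicSymm_nonneg (k N : ℕ) : 0 ≤ harmonicSymm k N := by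
  induction k generalizing N with
  | zero => simp [harmonicSymm_zero]
  | succ k ih =>
    rw [harmonicSymm_succ]
    exact Finset.sum_nonneg fun n _ => div_nonneg (ih n) (by positivity)

theorem hasDerivAt_neg_log_one_sub_pow (k : ℕ) {s : ℝ} (hs : s < 1) :
    HasDerivAt (fun s => (-Real.log (1 - s)) ^ (k + 1) / ((k + 1).factorial : ℝ))
      ((-Real.log (1 - s)) ^ k / (k.factorial : ℝ) * (1 - s)⁻¹) s := by
  have h1 : HasDerivAt (fun s : ℝ => -Real.log (1 - s)) ((1 - s)⁻¹) s := by
    have h0 : HasDerivAt (fun s : ℝ => 1 - s) (-1) s := by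
      simpa using (hasDerivAt_id s).const_sub 1
    refine (h0.log (by linarith)).neg.congr_deriv ?_
    rw [neg_div, neg_neg, one_div]
  refine ((h1.fun_pow (k + 1)).div_const _).congr_deriv ?_
  have : (k.factorial : ℝ) ≠ 0 := by positivity
  rw [Nat.factorial_succ]
  push_cast
  field_simp

/-- The Taylor expansion of the powers of `-log (1 - t)`. -/
theorem hasSum_neg_log_one_sub_pow (k : ℕ) {t : ℝ} (ht : |t| < 1) :
    HasSum (fun n : ℕ => harmonicSymm k n / ((n : ℝ) + 1) * t ^ (n + 1))
      ((-Real.log (1 - t)) ^ (k + 1) / ((k + 1).factorial : ℝ)) := by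
  induction k generalizing t with
  | zero =>
    simp only [harmonicSymm_zero, zero_add, pow_one, Nat.factorial_one, Nat.cast_one, div_one]
    refine (Real.hasSum_pow_div_log_of_abs_lt_one ht).congr_fun fun n => ?_
    ring
  | succ k ih =>
    -- Multiplying by `1/(1 - s)` replaces coefficients by their partial sums, which raises the
    -- degree of `harmonicSymm`; the product is the derivative of the next power of the logarithm.
    have hcauchy : ∀ s : ℝ, |s| < 1 →
        HasSum (fun n : ℕ => harmonicSymm (k + 1) (n + 1) * s ^ (n + 1))
          ((-Real.log (1 - s)) ^ (k + 1) / ((k + 1).factorial : ℝ) * (1 - s)⁻¹) := by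
      intro s hs
      have hA := ih hs
      have hAn : Summable fun n : ℕ => ‖harmonicSymm k n / ((n : ℝ) + 1) * s ^ (n + 1)‖ := by
        have h := (ih (t := |s|) (by rwa [abs_abs])).summable
        refine h.congr fun n => ?_
        rw [norm_mul, norm_pow, Real.norm_of_nonneg (div_nonneg (harmonicSymm_nonneg k n)
          (by positivity)), Real.norm_eq_abs]
      have hB := hasSum_geometric_of_abs_lt_one hs
      have hBn : Summable fun n : ℕ => ‖s ^ n‖ := by
        simpa using summable_geometric_of_abs_lt_one (r := |s|) (by rwa [abs_abs])
      have h := hasSum_sum_range_mul_of_summable_norm hAn hBn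
      rw [hA.tsum_eq, hB.tsum_eq] at h
      refine h.congr_fun fun n => ?_
      rw [harmonicSymm_succ, Finset.sum_mul]
      refine Finset.sum_congr rfl fun i hi => ?_
      have : i + 1 + (n - i) = n + 1 := by have := Finset.mem_range.1 hi; omega
      rw [mul_assoc, ← pow_add, this]
    have hlt : ∀ s ∈ Set.uIcc 0 t, |s| ≤ |t| := by
      intro s hs
      simpa using Set.abs_sub_left_of_mem_uIcc hs
    have hFTC : ∫ s in (0 : ℝ)..t,
        (-Real.log (1 - s)) ^ (k + 1) / ((k + 1).factorial : ℝ) * (1 - s)⁻¹ =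
        (-Real.log (1 - t)) ^ (k + 1 + 1) / ((k + 1 + 1).factorial : ℝ) := by
      have hne : ∀ s ∈ Set.uIcc 0 t, 1 - s ≠ 0 := fun s hs => by
        have := (abs_lt.1 ((hlt s hs).trans_lt ht)).2
        linarith
      rw [intervalIntegral.integral_eq_sub_of_hasDerivAt (fun s hs =>
        hasDerivAt_neg_log_one_sub_pow (k + 1) (abs_lt.1 ((hlt s hs).trans_lt ht)).2)]
      · simp
      · refine ContinuousOn.intervalIntegrable ?_
        refine ContinuousOn.mul (ContinuousOn.div_const (ContinuousOn.pow (ContinuousOn.neg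
          (ContinuousOn.log (by fun_prop) hne)) _) _) (ContinuousOn.inv₀ (by fun_prop) hne)
    have hsum := intervalIntegral.hasSum_integral_of_dominated_convergence (a := 0) (b := t)
      (μ := volume) (F := fun (n : ℕ) s => harmonicSymm (k + 1) (n + 1) * s ^ (n + 1))
      (f := fun s => (-Real.log (1 - s)) ^ (k + 1) / ((k + 1).factorial : ℝ) * (1 - s)⁻¹)
      (fun (n : ℕ) _ => harmonicSymm (k + 1) (n + 1) * |t| ^ (n + 1))
      (fun n => (by fun_prop : Measurable _).aestronglyMeasurable)
      (fun n => ae_of_all _ fun s hs => by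
        rw [norm_mul, norm_pow, Real.norm_of_nonneg (harmonicSymm_nonneg _ _), Real.norm_eq_abs]
        exact mul_le_mul_of_nonneg_left (pow_le_pow_left₀ (abs_nonneg _)
          (hlt s (Set.uIoc_subset_uIcc hs)) _) (harmonicSymm_nonneg _ _))
      (ae_of_all _ fun s _ => (hcauchy |t| (by rwa [abs_abs])).summable)
      (by simp)
      (ae_of_all _ fun s hs => hcauchy s ((hlt s (Set.uIoc_subset_uIcc hs)).trans_lt ht))
    rw [hFTC] at hsum
    have hterm : ∀ n : ℕ, ∫ s in (0 : ℝ)..t, harmonicSymm (k + 1) (n + 1) * s ^ (n + 1) =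
        harmonicSymm (k + 1) (n + 1) / (((n + 1 : ℕ) : ℝ) + 1) * t ^ (n + 1 + 1) := by
      intro n
      rw [intervalIntegral.integral_const_mul, integral_pow]
      simp
      ring
    simp_rw [hterm] at hsum
    -- The term of index `0` vanishes, since `harmonicSymm (k + 1) 0` is an empty sum.
    rw [← hasSum_nat_add_iff' 1]
    simpa [harmonicSymm_succ] using hsum

theorem image_exp_neg_Ioi : (fun x : ℝ => Real.exp (-x)) '' Set.Ioi 0 = Set.Ioo 0 1 := by
  ext t
  constructor
  · rintro ⟨x, hx, rfl⟩
    exact ⟨Real.exp_pos _, by simpa using hx⟩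
  · intro ht
    exact ⟨-Real.log t, by simpa using Real.log_neg ht.1 ht.2, by simp [Real.exp_log ht.1]⟩

theorem integral_neg_log_pow (m : ℕ) :
    ∫ t in Set.Ioo (0 : ℝ) 1, (-Real.log t) ^ m = m.factorial := by
  have h := integral_image_eq_integral_abs_deriv_smul (s := Set.Ioi (0 : ℝ)) measurableSet_Ioi
    (f := fun x => Real.exp (-x)) (f' := fun x => -Real.exp (-x))
    (fun x _ => by simpa using ((hasDerivAt_neg x).exp).hasDerivWithinAt)
    (fun a _ b _ hab => by simpa using hab) (fun t => (-Real.log t) ^ m)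
  rw [image_exp_neg_Ioi] at h
  rw [h, ← Real.Gamma_nat_eq_factorial, Real.Gamma_eq_integral (by positivity)]
  refine setIntegral_congr_fun measurableSet_Ioi fun x _ => ?_
  simp

theorem integrableOn_neg_log_pow_mul_pow (m n : ℕ) :
    IntegrableOn (fun t : ℝ => (-Real.log t) ^ m * t ^ n) (Set.Ioo 0 1) := by
  have hI := (integrableOn_beta_kernel (e := 1 / 2) (a := 0) (by norm_num) (by norm_num)).const_mul
    (m.factorial / (1 / 2 : ℝ) ^ m)
  refine Integrable.mono' hI (Measurable.aestronglyMeasurable (by fun_prop)) ?_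
  refine (ae_restrict_iff' measurableSet_Ioo).2 (ae_of_all _ fun t ht => ?_)
  have hx := neg_log_nonneg ht
  have ht0 := ht.1
  have h := pow_mul_le_exp hx (c := 1 / 2) (by norm_num) m
  rw [exp_neg_log_mul ht.1] at h
  rw [Real.norm_of_nonneg (by positivity), neg_zero, Real.rpow_zero, mul_one]
  exact (mul_le_of_le_one_right (by positivity) (pow_le_one₀ ht0.le ht.2.le)).trans h

theorem integral_neg_log_pow_mul_pow (m n : ℕ) :
    ∫ t in Set.Ioo (0 : ℝ) 1, (-Real.log t) ^ m * t ^ n =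
      m.factorial / ((n : ℝ) + 1) ^ (m + 1) := by
  -- The substitution `t ↦ t^(n+1)` reduces to the case `n = 0`.
  have h := integral_log_pow_mul_comp_pow (Nat.succ_pos n) m (fun t => (-1) ^ m * t)
  have e1 : ∀ t ∈ Set.Ioo (0 : ℝ) 1, Real.log t ^ m * ((-1) ^ m * t ^ n.succ) / t =
      (-Real.log t) ^ m * t ^ n := by
    intro t ht
    have := ht.1.ne'
    rw [neg_pow (Real.log t), pow_succ]
    field_simp
  have e2 : ∀ t ∈ Set.Ioo (0 : ℝ) 1, Real.log t ^ m * ((-1) ^ m * t) / t = (-Real.log t) ^ m := by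
    intro t ht
    have := ht.1.ne'
    rw [neg_pow (Real.log t)]
    field_simp
  rw [setIntegral_congr_fun measurableSet_Ioo e1, setIntegral_congr_fun measurableSet_Ioo e2,
    integral_neg_log_pow] at h
  rw [h, one_div, inv_pow]
  push_cast
  ring

theorem nielsenS_succ_succ_eq (m k : ℕ) (z : ℝ) :
    nielsenS (m + 1) (k + 1) z = 1 / m.factorial * ∫ t in Set.Ioo (0 : ℝ) 1,
      (-Real.log t) ^ m * ((-Real.log (1 - z * t)) ^ (k + 1) / ((k + 1).factorial : ℝ) / t) := by
  have h := nielsenS_neg_eq (m + 1) (k + 1) (-z)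
  rw [neg_neg] at h
  rw [h, ← integral_const_mul, ← integral_const_mul]
  refine setIntegral_congr_fun measurableSet_Ioo fun t _ => ?_
  simp only [Nat.add_sub_cancel, show m + 1 + (k + 1) - 1 = m + (k + 1) by omega]
  rw [neg_pow (Real.log t), neg_pow (Real.log (1 - z * t)), show 1 + -z * t = 1 - z * t by ring,
    pow_add]
  ring

/-- All Taylor coefficients are nonnegative, so the integral of the full sum bounds every partial
sum; no growth estimate for `harmonicSymm` is needed. This case `z = 1` dominates all `|z| ≤ 1`. -/
theorem summable_harmonicSymm_div (m k : ℕ) :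
    Summable fun n : ℕ => harmonicSymm k n / ((n : ℝ) + 1) *
      ∫ t in Set.Ioo (0 : ℝ) 1, (-Real.log t) ^ m * t ^ n := by
  refine summable_of_sum_le (c := ∫ t in Set.Ioo (0 : ℝ) 1,
    (-Real.log t) ^ m * (-Real.log (1 - t)) ^ (k + 1) / t * (1 / (k + 1).factorial)) ?_ ?_
  · intro n
    refine mul_nonneg (div_nonneg (harmonicSymm_nonneg k n) (by positivity)) ?_
    rw [integral_neg_log_pow_mul_pow]
    positivity
  · intro s
    simp_rw [← integral_const_mul]
    have hI : ∀ n ∈ s, IntegrableOn (fun t : ℝ => harmonicSymm k n / ((n : ℝ) + 1) *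
        ((-Real.log t) ^ m * t ^ n)) (Set.Ioo 0 1) := fun n _ =>
      (integrableOn_neg_log_pow_mul_pow m n).const_mul _
    rw [← integral_finsetSum _ hI]
    refine setIntegral_mono_on (integrable_finsetSum _ hI)
      ((integrableOn_log_pow_mul_log_pow m (by omega)).mul_const _) measurableSet_Ioo
      fun t ht => ?_
    have hx := neg_log_nonneg ht
    have ht0 := ht.1
    have h := sum_le_hasSum s (fun n _ => mul_nonneg (div_nonneg (harmonicSymm_nonneg k n)
      (by positivity)) (pow_nonneg ht0.le (n + 1)))
      (hasSum_neg_log_one_sub_pow k (t := t) (by rw [abs_of_pos ht0]; exact ht.2))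
    have e : ∑ n ∈ s, harmonicSymm k n / ((n : ℝ) + 1) * ((-Real.log t) ^ m * t ^ n) =
        (-Real.log t) ^ m * (∑ n ∈ s, harmonicSymm k n / ((n : ℝ) + 1) * t ^ (n + 1)) / t := by
      rw [Finset.mul_sum, Finset.sum_div]
      refine Finset.sum_congr rfl fun n _ => ?_
      rw [pow_succ]
      field_simp
    rw [e, div_mul_eq_mul_div, mul_assoc]
    refine div_le_div_of_nonneg_right (mul_le_mul_of_nonneg_left ?_ (by positivity)) ht0.le
    rwa [mul_one_div]

/-- Nielsen's polylogarithm as a multiple polylogarithm series. -/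
theorem hasSum_nielsenS (m k : ℕ) {z : ℝ} (hz : |z| ≤ 1) :
    HasSum (fun n : ℕ => z ^ (n + 1) / ((n : ℝ) + 1) ^ (m + 2) * harmonicSymm k n)
      (nielsenS (m + 1) (k + 1) z) := by
  have hI : ∀ n : ℕ, Integrable (fun t : ℝ => harmonicSymm k n / ((n : ℝ) + 1) * z ^ (n + 1) *
      ((-Real.log t) ^ m * t ^ n)) (volume.restrict (Set.Ioo 0 1)) := fun n =>
    (integrableOn_neg_log_pow_mul_pow m n).const_mul _
  have hS : Summable fun n : ℕ => ∫ t in Set.Ioo (0 : ℝ) 1,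
      ‖harmonicSymm k n / ((n : ℝ) + 1) * z ^ (n + 1) * ((-Real.log t) ^ m * t ^ n)‖ := by
    refine Summable.of_nonneg_of_le (fun n => integral_nonneg fun t => norm_nonneg _)
      (fun n => ?_) (summable_harmonicSymm_div m k)
    have hc := div_nonneg (harmonicSymm_nonneg k n) (by positivity : (0 : ℝ) ≤ (n : ℝ) + 1)
    rw [← integral_const_mul]
    refine setIntegral_mono_on (hI n).norm ((integrableOn_neg_log_pow_mul_pow m n).const_mul _)
      measurableSet_Ioo fun t ht => ?_
    have hx := neg_log_nonneg ht
    have ht0 := ht.1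
    have hp : 0 ≤ (-Real.log t) ^ m * t ^ n := by positivity
    rw [norm_mul, norm_mul, norm_pow, Real.norm_of_nonneg hc, Real.norm_of_nonneg hp]
    refine mul_le_mul_of_nonneg_right (mul_le_of_le_one_right hc ?_) hp
    exact pow_le_one₀ (norm_nonneg _) hz
  have h := (hasSum_integral_of_summable_integral_norm hI hS).mul_left (1 / m.factorial : ℝ)
  rw [nielsenS_succ_succ_eq]
  have e : ∫ t in Set.Ioo (0 : ℝ) 1, ∑' n : ℕ, harmonicSymm k n / ((n : ℝ) + 1) * z ^ (n + 1) *
      ((-Real.log t) ^ m * t ^ n) = ∫ t in Set.Ioo (0 : ℝ) 1,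
      (-Real.log t) ^ m * ((-Real.log (1 - z * t)) ^ (k + 1) / ((k + 1).factorial : ℝ) / t) := by
    refine setIntegral_congr_fun measurableSet_Ioo fun t ht => ?_
    have hzt : |z * t| < 1 := by
      rw [abs_mul, abs_of_pos ht.1]
      nlinarith [ht.1, ht.2, abs_nonneg z]
    refine (((hasSum_neg_log_one_sub_pow k hzt).div_const t).mul_left
      ((-Real.log t) ^ m) |>.congr_fun fun n => ?_).tsum_eq
    have := ht.1.ne'
    rw [mul_pow, pow_succ t]
    field_simp
  rw [e] at h
  refine h.congr_fun fun n => ?_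
  rw [integral_const_mul, integral_neg_log_pow_mul_pow]
  have : (m.factorial : ℝ) ≠ 0 := by positivity
  field_simp
  ring

theorem tendsto_mzvTrunc_plainArgs (m k : ℕ) :
    Tendsto (mzvTrunc (plainArgs (m + 2) k)) atTop (𝓝 (nielsenS (m + 1) (k + 1) 1)) := by
  refine (hasSum_nielsenS m k (z := 1) (by simp)).tendsto_sum_nat.congr fun N => ?_
  rw [plainArgs, mzvTrunc_cons]
  simp [harmonicSymm]

theorem tendsto_mzvTrunc_barArgs (m k : ℕ) :
    Tendsto (mzvTrunc (barArgs (m + 2) k)) atTop (𝓝 (nielsenS (m + 1) (k + 1) (-1))) := by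
  refine (hasSum_nielsenS m k (z := -1) (by simp)).tendsto_sum_nat.congr fun N => ?_
  rw [barArgs, mzvTrunc_cons]
  simp [harmonicSymm]

theorem mzv_plainArgs (m k : ℕ) : mzv (plainArgs (m + 2) k) = nielsenS (m + 1) (k + 1) 1 :=
  (tendsto_mzvTrunc_plainArgs m k).limUnder_eq

theorem mzv_barArgs (m k : ℕ) : mzv (barArgs (m + 2) k) = nielsenS (m + 1) (k + 1) (-1) :=
  (tendsto_mzvTrunc_barArgs m k).limUnder_eq

/-! ### Coefficients lying in a `ℚ`-subalgebra of `ℝ`. -/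

/-- A power series converging at some nonzero point has its coefficients as derivatives at `0`. -/
theorem analyticAt_and_iteratedDeriv_tsum {c : ℕ → ℝ} {r : ℝ} (hr : r ≠ 0)
    (hc : Summable fun n => c n * r ^ n) :
    AnalyticAt ℝ (fun z => ∑' n, c n * z ^ n) 0 ∧
      ∀ n, iteratedDeriv n (fun z => ∑' n, c n * z ^ n) 0 = n.factorial * c n := by
  have h : HasFPowerSeriesAt (fun z => ∑' n, c n * z ^ n)
      (FormalMultilinearSeries.ofScalars ℝ c) 0 := by
    rw [hasFPowerSeriesAt_iff]
    filter_upwards [Metric.ball_mem_nhds (0 : ℝ) (abs_pos.2 hr)] with z hz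
    have hz' : |z| ≤ |r| := by
      rw [mem_ball_zero_iff] at hz
      exact hz.le
    have hs : Summable fun n => c n * z ^ n := by
      refine Summable.of_norm_bounded hc.norm fun n => ?_
      rw [norm_mul, norm_mul, norm_pow, norm_pow]
      exact mul_le_mul_of_nonneg_left (pow_le_pow_left₀ (norm_nonneg _) hz' n) (norm_nonneg _)
    simpa [mul_comm] using hs.hasSum
  refine ⟨h.analyticAt, fun n => ?_⟩
  have e := h.analyticAt.hasFPowerSeriesAt.eq_formalMultilinearSeries h
  have e2 := FormalMultilinearSeries.ofScalars_series_injective ℝ ℝ e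
  have e3 := congrFun e2 n
  rw [← e3]
  have : (n.factorial : ℝ) ≠ 0 := by positivity
  field_simp

/-- With `E = exp ∘ h`, Leibniz' rule for `E' = h' E` expresses each derivative through lower ones
with natural coefficients. -/
theorem iteratedDeriv_exp_comp_mem (A : Subalgebra ℚ ℝ) {h : ℝ → ℝ} (ha : AnalyticAt ℝ h 0)
    (h0 : Real.exp (h 0) ∈ A) (hA : ∀ n, iteratedDeriv n h 0 ∈ A) (n : ℕ) :
    iteratedDeriv n (fun z => Real.exp (h z)) 0 ∈ A := by
  induction n using Nat.strong_induction_on with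
  | _ n ih =>
    cases n with
    | zero => simpa using h0
    | succ n =>
      have hE : AnalyticAt ℝ (fun z => Real.exp (h z)) 0 := ha.rexp
      have hd : deriv (fun z => Real.exp (h z)) =ᶠ[𝓝 0] fun z => deriv h z * Real.exp (h z) := by
        filter_upwards [ha.eventually_analyticAt] with z hz
        rw [deriv_exp hz.differentiableAt, mul_comm]
      rw [iteratedDeriv_succ', hd.iteratedDeriv_eq,
        iteratedDeriv_fun_mul ha.deriv.contDiffAt hE.contDiffAt]
      refine A.sum_mem fun i hi => A.mul_mem (A.mul_mem (natCast_mem A _) ?_) (ih _ (by omega))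
      rw [← iteratedDeriv_succ']
      exact hA _

/-- The Vandermonde matrix at the nodes `0, …, N-1` has a rational inverse, so each coefficient is a
rational combination of the values. -/
theorem mem_of_forall_sum_pow_mul_mem (A : Subalgebra ℚ ℝ) {N : ℕ} (v : Fin N → ℝ)
    (h : ∀ k : ℕ, ∑ n : Fin N, (k : ℝ) ^ (n : ℕ) * v n ∈ A) (n : Fin N) : v n ∈ A := by
  set V : Matrix (Fin N) (Fin N) ℚ := Matrix.vandermonde fun i => ((i : ℕ) : ℚ)
  have hV : IsUnit V.det := by
    rw [isUnit_iff_ne_zero, Matrix.det_vandermonde_ne_zero_iff]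
    intro i j hij
    simp only [Nat.cast_inj] at hij
    exact Fin.ext hij
  have hinv := Matrix.nonsing_inv_mul V hV
  have e : v n = ∑ i, (V⁻¹ n i : ℚ) • ∑ j : Fin N, ((i : ℕ) : ℝ) ^ (j : ℕ) * v j := by
    simp_rw [Finset.smul_sum, Rat.smul_def, ← mul_assoc]
    rw [Finset.sum_comm]
    simp_rw [← Finset.sum_mul]
    have e1 : ∀ j : Fin N, ∑ i : Fin N, ((V⁻¹ n i : ℚ) : ℝ) * ((i : ℕ) : ℝ) ^ (j : ℕ) =
        (((1 : Matrix (Fin N) (Fin N) ℚ) n j : ℚ) : ℝ) := by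
      intro j
      rw [← hinv, Matrix.mul_apply]
      push_cast
      simp [V, Matrix.vandermonde_apply]
    rw [Finset.sum_eq_single n (fun j _ hj => by rw [e1, Matrix.one_apply_ne hj.symm]; simp)
      (by simp), e1, Matrix.one_apply_eq]
    simp
  rw [e]
  exact A.sum_mem fun i _ => A.smul_mem (h i) _

/-! ### Zeta values and the logarithm of `Γ(1+x)Γ(1+y)/Γ(1+x+y)`. -/

/-- The real zeta value `ζ(i)`, for `i ≥ 2`. -/
def realZeta (i : ℕ) : ℝ := ∑' n : ℕ, 1 / ((n : ℝ) + 1) ^ i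

theorem summable_one_div_add_one_pow {i : ℕ} (hi : 2 ≤ i) :
    Summable fun n : ℕ => 1 / ((n : ℝ) + 1) ^ i := by
  have h := (summable_nat_add_iff 1).2 (Real.summable_one_div_nat_pow.2 (by omega : 1 < i))
  exact_mod_cast h

theorem ofReal_realZeta {i : ℕ} (hi : 2 ≤ i) : ((realZeta i : ℝ) : ℂ) = riemannZeta i := by
  have h : Summable fun n : ℕ => 1 / (n : ℂ) ^ i := by
    simpa using Complex.ofRealCLM.summable (Real.summable_one_div_nat_pow.2 (by omega : 1 < i))
  have : i ≠ 0 := by omega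
  rw [zeta_nat_eq_tsum_of_gt_one (by omega), realZeta, Complex.ofReal_tsum, h.tsum_eq_zero_add]
  simp [this]

theorem hasSum_log_one_add {u : ℝ} (hu : |u| < 1) :
    HasSum (fun k : ℕ => (-1) ^ k * u ^ (k + 1) / ((k : ℝ) + 1)) (Real.log (1 + u)) := by
  have h := (Real.hasSum_pow_div_log_of_abs_lt_one (x := -u) (by rwa [abs_neg])).neg
  rw [neg_neg, sub_neg_eq_add] at h
  refine h.congr_fun fun k => ?_
  rw [neg_pow]
  ring

theorem hasSum_log_sub_log_sub_log {x y : ℝ} (hx : 0 < x) (hy : 0 < y) (hxy : x + y < 1) (m : ℕ) :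
    HasSum (fun k : ℕ => (-1) ^ k * (x ^ (k + 2) + y ^ (k + 2) - (x + y) ^ (k + 2)) /
        ((k : ℝ) + 2) * (1 / ((m : ℝ) + 1) ^ (k + 2)))
      (Real.log (1 + (x + y) / (m + 1)) - Real.log (1 + x / (m + 1)) -
        Real.log (1 + y / (m + 1))) := by
  have hlt : ∀ u : ℝ, 0 < u → u < 1 → |u / (m + 1)| < 1 := by
    intro u h0 h1
    have : (0 : ℝ) ≤ m := by positivity
    rw [abs_of_pos (by positivity), div_lt_one (by positivity)]
    linarith
  have h := ((hasSum_log_one_add (hlt (x + y) (by linarith) hxy)).sub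
    (hasSum_log_one_add (hlt x hx (by linarith)))).sub
    (hasSum_log_one_add (hlt y hy (by linarith)))
  -- The linear terms cancel, as `(x + y) - x - y = 0`; hence only `ζ(2), ζ(3), …` will occur.
  rw [← hasSum_nat_add_iff' 1] at h
  rw [Finset.sum_range_one] at h
  have e : Real.log (1 + (x + y) / (m + 1)) - Real.log (1 + x / (m + 1)) -
      Real.log (1 + y / (m + 1)) - ((-1) ^ 0 * ((x + y) / (m + 1)) ^ (0 + 1) / (((0 : ℕ) : ℝ) + 1) -
      (-1) ^ 0 * (x / (m + 1)) ^ (0 + 1) / (((0 : ℕ) : ℝ) + 1) -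
      (-1) ^ 0 * (y / (m + 1)) ^ (0 + 1) / (((0 : ℕ) : ℝ) + 1)) =
      Real.log (1 + (x + y) / (m + 1)) - Real.log (1 + x / (m + 1)) -
      Real.log (1 + y / (m + 1)) := by
    push_cast
    ring
  rw [e] at h
  refine h.congr_fun fun k => ?_
  rw [div_pow, div_pow, div_pow, pow_succ (-1 : ℝ)]
  push_cast
  generalize ((m : ℝ) + 1) ^ (k + 1 + 1) = M
  rw [show (k : ℝ) + 1 + 1 = k + 2 by ring]
  ring

/-- Euler's limit formula for the three gamma factors: `log n` survives with total weight `(1+x) +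
(1+y) - (1+x+y) = 1` and is cancelled in the limit by the `log(n+1)` left over from `log n!`. -/
theorem hasSum_log_Gamma_add_sub {x y : ℝ} (hx : 0 < x) (hy : 0 < y)
    (hs : Summable (fun m : ℕ => Real.log (1 + (x + y) / (m + 1)) - Real.log (1 + x / (m + 1)) -
        Real.log (1 + y / (m + 1)))) :
    HasSum (fun m : ℕ => Real.log (1 + (x + y) / (m + 1)) - Real.log (1 + x / (m + 1)) -
        Real.log (1 + y / (m + 1)))
      (Real.log (Real.Gamma (1 + x)) + Real.log (Real.Gamma (1 + y)) -
        Real.log (Real.Gamma (1 + (x + y)))) := by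
  have h1 := ((Real.BohrMollerup.tendsto_log_gamma (show 0 < 1 + x by linarith)).add
    (Real.BohrMollerup.tendsto_log_gamma (show 0 < 1 + y by linarith))).sub
    (Real.BohrMollerup.tendsto_log_gamma (show 0 < 1 + (x + y) by linarith))
  have h2 := hs.hasSum.tendsto_sum_nat.comp (tendsto_add_atTop_nat 1)
  have h3 : Tendsto (fun n : ℕ => Real.log n - Real.log (n + 1)) atTop (𝓝 0) := by
    have h4 : Tendsto (fun n : ℕ => (n : ℝ) / (n + 1)) atTop (𝓝 1) :=
      tendsto_natCast_div_add_atTop 1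
    have h5 := h4.log one_ne_zero
    rw [Real.log_one] at h5
    refine h5.congr' ?_
    filter_upwards [eventually_gt_atTop 0] with n hn
    rw [Real.log_div (by positivity) (by positivity)]
  have h6 := h3.add h2
  rw [zero_add] at h6
  have h7 := tendsto_nhds_unique (h1.congr fun n => ?_) h6
  · rw [h7]
    exact hs.hasSum
  · have hf : Real.log (n.factorial : ℝ) =
        ∑ m ∈ Finset.range (n + 1), Real.log ((m : ℝ) + 1) - Real.log ((n : ℝ) + 1) := by
      rw [Finset.sum_range_succ, add_sub_cancel_right, ← Finset.prod_range_add_one_eq_factorial]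
      push_cast
      rw [Real.log_prod (fun i _ => by positivity)]
    have hl : ∀ u : ℝ, 0 < u → ∀ m : ℕ, Real.log (1 + u + m) =
        Real.log ((m : ℝ) + 1) + Real.log (1 + u / (m + 1)) := by
      intro u hu m
      rw [← Real.log_mul (by positivity) (by positivity)]
      congr 1
      field_simp
      ring
    simp only [Real.BohrMollerup.logGammaSeq, Function.comp, hl x hx, hl y hy, hl (x + y) (by linarith),
      Finset.sum_add_distrib, Finset.sum_sub_distrib, hf]
    ring

theorem hasSum_log_Gamma_add_sub_zeta {x y : ℝ} (hx : 0 < x) (hy : 0 < y) (hxy : x + y < 1) :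
    HasSum (fun k : ℕ => (-1) ^ k * (x ^ (k + 2) + y ^ (k + 2) - (x + y) ^ (k + 2)) /
        ((k : ℝ) + 2) * realZeta (k + 2))
      (Real.log (Real.Gamma (1 + x)) + Real.log (Real.Gamma (1 + y)) -
        Real.log (Real.Gamma (1 + (x + y)))) := by
  set F : ℕ × ℕ → ℝ := fun p => (-1) ^ p.2 * (x ^ (p.2 + 2) + y ^ (p.2 + 2) - (x + y) ^ (p.2 + 2)) /
        ((p.2 : ℝ) + 2) * (1 / ((p.1 : ℝ) + 1) ^ (p.2 + 2)) with hF
  -- The majorant `2 (x+y)^k / (m+1)^2` allows the sums over `m` and `k` to be interchanged.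
  have hS : Summable F := by
    have h1 := Summable.mul_of_nonneg (summable_one_div_add_one_pow (le_refl 2))
      ((summable_geometric_of_lt_one (by linarith) hxy).mul_left 2)
      (fun m => by positivity) (fun k => by simp only [Pi.zero_apply]; positivity)
    refine Summable.of_norm_bounded h1 fun p => ?_
    obtain ⟨m, k⟩ := p
    have hm : (1 : ℝ) ≤ (m : ℝ) + 1 := by linarith [(Nat.cast_nonneg m : (0 : ℝ) ≤ m)]
    have b1 : x ^ (k + 2) ≤ (x + y) ^ (k + 2) := pow_le_pow_left₀ hx.le (by linarith) _
    have b2 : y ^ (k + 2) ≤ (x + y) ^ (k + 2) := pow_le_pow_left₀ hy.le (by linarith) _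
    have b3 : (x + y) ^ (k + 2) ≤ (x + y) ^ k :=
      pow_le_pow_of_le_one (by linarith) hxy.le (by omega)
    have b4 : |x ^ (k + 2) + y ^ (k + 2) - (x + y) ^ (k + 2)| ≤ 2 * (x + y) ^ k := by
      have p1 : 0 < x ^ (k + 2) := by positivity
      have p2 : 0 < y ^ (k + 2) := by positivity
      rw [abs_le]
      constructor <;> linarith
    have b5 : 1 / ((m : ℝ) + 1) ^ (k + 2) ≤ 1 / ((m : ℝ) + 1) ^ 2 :=
      one_div_le_one_div_of_le (by positivity) (pow_le_pow_right₀ hm (by omega))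
    simp only [hF]
    rw [norm_mul, norm_div, norm_mul, norm_pow, norm_neg, norm_one, one_pow, one_mul,
      Real.norm_eq_abs, Real.norm_of_nonneg (by positivity : (0 : ℝ) ≤ (k : ℝ) + 2),
      Real.norm_of_nonneg (by positivity : (0 : ℝ) ≤ 1 / ((m : ℝ) + 1) ^ (k + 2)), mul_comm]
    refine mul_le_mul b5 ?_ (by positivity) (by positivity)
    refine (div_le_self (abs_nonneg _) ?_).trans b4
    linarith [(Nat.cast_nonneg k : (0 : ℝ) ≤ k)]
  have h1 := hS.hasSum.prod_fiberwise (fun m => hasSum_log_sub_log_sub_log hx hy hxy m)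
  have h2 := (hasSum_log_Gamma_add_sub hx hy h1.summable).unique h1
  rw [h2]
  have hS' : HasSum (F ∘ Prod.swap) (∑' p, F p) :=
    (Equiv.prodComm ℕ ℕ).hasSum_iff.2 hS.hasSum
  refine hS'.prod_fiberwise fun k => ?_
  exact (summable_one_div_add_one_pow (i := k + 2) (by omega)).hasSum.mul_left _

/-! ### The beta integral as generating function of `S_{m,k}(1)`. -/

theorem integrableOn_rpow_mul_one_sub_rpow {a b : ℝ} (ha : 0 < a) (hb : 0 < b) :
    IntegrableOn (fun t : ℝ => t ^ (a - 1) * (1 - t) ^ (b - 1)) (Set.Ioo 0 1) := by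
  have h := integrableOn_beta_kernel (e := 1 - a) (a := 1 - b) (by linarith) (by linarith)
  simpa using h

theorem integral_rpow_mul_one_sub_rpow {a b : ℝ} (ha : 0 < a) (hb : 0 < b) :
    ∫ t in Set.Ioo (0 : ℝ) 1, t ^ (a - 1) * (1 - t) ^ (b - 1) =
      Real.Gamma a * Real.Gamma b / Real.Gamma (a + b) := by
  have h : Complex.betaIntegral a b =
      ((∫ t in Set.Ioo (0 : ℝ) 1, t ^ (a - 1) * (1 - t) ^ (b - 1) : ℝ) : ℂ) := by
    rw [Complex.betaIntegral, intervalIntegral.integral_of_le zero_le_one,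
      integral_Ioc_eq_integral_Ioo, ← integral_complex_ofReal]
    refine setIntegral_congr_fun measurableSet_Ioo fun t ht => ?_
    have h1 := one_sub_mem ht
    push_cast
    rw [Complex.ofReal_cpow ht.1.le, Complex.ofReal_cpow h1.1.le]
    push_cast
    rfl
  have h2 := ProbabilityTheory.beta_eq_betaIntegralReal a b ha hb
  rw [h, Complex.ofReal_re] at h2
  exact h2.symm

/-- The beta integral with its singularity at `a = 0` removed. -/
theorem one_add_mul_integral_eq_Gamma {x y : ℝ} (hx : 0 < x) (hy : 0 < y) :
    1 + x * ∫ t in Set.Ioo (0 : ℝ) 1, Real.exp (-x * -Real.log t) *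
      (Real.exp (-y * -Real.log (1 - t)) - 1) / t =
      Real.Gamma (1 + x) * Real.Gamma (1 + y) / Real.Gamma (1 + (x + y)) := by
  -- A difference of the beta integrands with parameters `(x, 1+y)` and `(x, 1)`; the second
  -- integrates to `1/x` and cancels the leading `1`.
  have e : ∀ t ∈ Set.Ioo (0 : ℝ) 1, Real.exp (-x * -Real.log t) *
      (Real.exp (-y * -Real.log (1 - t)) - 1) / t =
      t ^ (x - 1) * (1 - t) ^ ((1 + y) - 1) - t ^ (x - 1) * (1 - t) ^ ((1 : ℝ) - 1) := by
    intro t ht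
    rw [exp_neg_log_mul ht.1, exp_neg_log_mul (one_sub_mem ht).1, neg_neg, neg_neg,
      Real.rpow_sub_one ht.1.ne', sub_self, Real.rpow_zero, add_sub_cancel_left]
    ring
  rw [setIntegral_congr_fun measurableSet_Ioo e,
    integral_sub (integrableOn_rpow_mul_one_sub_rpow hx (by linarith))
      (integrableOn_rpow_mul_one_sub_rpow hx one_pos),
    integral_rpow_mul_one_sub_rpow hx (by linarith), integral_rpow_mul_one_sub_rpow hx one_pos,
    Real.Gamma_one, show x + (1 + y) = 1 + (x + y) by ring, add_comm x 1, add_comm 1 x,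
    Real.Gamma_add_one hx.ne']
  have := (Real.Gamma_pos_of_pos hx).ne'
  have := (Real.Gamma_pos_of_pos (show 0 < 1 + (x + y) by linarith)).ne'
  field_simp
  ring

theorem hasSum_prod_mul {f g : ℕ → ℝ} {s t : ℝ} (hf : HasSum f s) (hg : HasSum g t) :
    HasSum (fun p : ℕ × ℕ => f p.1 * g p.2) (s * t) :=
  hf.mul hg (summable_mul_of_summable_norm hf.summable.norm hg.summable.norm)

theorem hasSum_exp_mul_exp_sub_one (a b : ℝ) :
    HasSum (fun p : ℕ × ℕ => a ^ p.1 / (p.1.factorial : ℝ) *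
      (b ^ (p.2 + 1) / ((p.2 + 1).factorial : ℝ))) (Real.exp a * (Real.exp b - 1)) := by
  have h : ∀ c : ℝ, HasSum (fun n : ℕ => c ^ n / (n.factorial : ℝ)) (Real.exp c) := fun c => by
    rw [Real.exp_eq_exp_ℝ]
    exact NormedSpace.expSeries_div_hasSum_exp c
  have hb : HasSum (fun n : ℕ => b ^ (n + 1) / ((n + 1).factorial : ℝ)) (Real.exp b - 1) := by
    have hb := (hasSum_nat_add_iff' 1).2 (h b)
    simpa only [Finset.sum_range_one, pow_zero, Nat.factorial_zero, Nat.cast_one, div_one] using hb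
  exact hasSum_prod_mul (h a) hb

/-- Both exponentials are expanded and integrated termwise. Taking absolute values amounts to
replacing `(-x, -y)` by `(x, y)`, and that integral still converges because `x, y < 1`. -/
theorem hasSum_nielsenS_mul_pow {x y : ℝ} (hx : 0 < x) (hx1 : x < 1) (hy : 0 < y) (hy1 : y < 1) :
    HasSum (fun p : ℕ × ℕ => (-x) ^ p.1 * (-y) ^ (p.2 + 1) * nielsenS (p.1 + 1) (p.2 + 1) 1)
      (∫ t in Set.Ioo (0 : ℝ) 1, Real.exp (-x * -Real.log t) *
        (Real.exp (-y * -Real.log (1 - t)) - 1) / t) := by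
  set G : ℕ × ℕ → ℝ → ℝ := fun p t => (-Real.log t) ^ p.1 * (-Real.log (1 - t)) ^ (p.2 + 1) / t
  have hG : ∀ p, IntegrableOn (G p) (Set.Ioo 0 1) := fun p =>
    integrableOn_log_pow_mul_log_pow p.1 (by omega)
  have hG0 : ∀ p, ∀ t ∈ Set.Ioo (0 : ℝ) 1, 0 ≤ G p t := fun p t ht => by
    have hX := neg_log_nonneg ht
    have hY := neg_log_nonneg (one_sub_mem ht)
    have := ht.1
    positivity
  set c : ℝ → ℝ → ℕ × ℕ → ℝ := fun u v p => u ^ p.1 / (p.1.factorial : ℝ) *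
    (v ^ (p.2 + 1) / ((p.2 + 1).factorial : ℝ))
  have hsum : ∀ u v t : ℝ, HasSum (fun p => c u v p * G p t)
      (Real.exp (u * -Real.log t) * (Real.exp (v * -Real.log (1 - t)) - 1) / t) := by
    intro u v t
    refine ((hasSum_exp_mul_exp_sub_one (u * -Real.log t) (v * -Real.log (1 - t))).div_const
      t).congr_fun fun p => ?_
    simp only [c, G, mul_pow]
    ring
  have hS : Summable fun p => ∫ t in Set.Ioo (0 : ℝ) 1, ‖c (-x) (-y) p * G p t‖ := by
    refine summable_of_sum_le (c := ∫ t in Set.Ioo (0 : ℝ) 1, Real.exp (x * -Real.log t) *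
      (Real.exp (y * -Real.log (1 - t)) - 1) / t) (fun p => integral_nonneg fun t => norm_nonneg _)
      fun s => ?_
    have hI : ∀ p ∈ s, IntegrableOn (fun t => ‖c (-x) (-y) p * G p t‖) (Set.Ioo 0 1) :=
      fun p _ => ((hG p).const_mul _).norm
    rw [← integral_finsetSum _ hI]
    refine setIntegral_mono_on (integrable_finsetSum _ hI)
      (integrableOn_exp_mul_exp_sub_one hx1 hy.le hy1) measurableSet_Ioo fun t ht => ?_
    have e : ∀ p, ‖c (-x) (-y) p * G p t‖ = c x y p * G p t := by
      intro p
      rw [norm_mul, Real.norm_of_nonneg (hG0 p t ht)]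
      simp only [c, norm_mul, norm_div, norm_pow, norm_neg, Real.norm_of_nonneg hx.le,
        Real.norm_of_nonneg hy.le, Real.norm_natCast]
    simp_rw [e]
    refine sum_le_hasSum s (fun p _ => mul_nonneg ?_ (hG0 p t ht)) (hsum x y t)
    simp only [c]
    positivity
  have h := hasSum_integral_of_summable_integral_norm (fun p => (hG p).const_mul (c (-x) (-y) p)) hS
  rw [integral_congr_ae (ae_of_all _ fun t => (hsum (-x) (-y) t).tsum_eq)] at h
  refine h.congr_fun fun p => ?_
  rw [nielsenS_succ_succ_eq, integral_const_mul]
  have e : ∫ t in Set.Ioo (0 : ℝ) 1, (-Real.log t) ^ p.1 *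
      ((-Real.log (1 - 1 * t)) ^ (p.2 + 1) / ((p.2 + 1).factorial : ℝ) / t) =
      1 / ((p.2 + 1).factorial : ℝ) * ∫ t in Set.Ioo (0 : ℝ) 1, G p t := by
    rw [← integral_const_mul]
    refine setIntegral_congr_fun measurableSet_Ioo fun t _ => ?_
    simp only [G, one_mul]
    ring
  rw [e]
  simp only [c]
  ring

/-! ### Polynomiality of `S_{m,k}(1)` in zeta values. -/

/-- The coefficients in `w` of `1 + w ∫ t^{-w-1} ((1 - t)^{-r w} - 1) dt`. -/
def betaSeriesCoeff (r : ℝ) : ℕ → ℝ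
  | 0 => 1
  | 1 => 0
  | p + 2 => -∑ x ∈ Finset.HasAntidiagonal.antidiagonal p, r ^ (x.2 + 1) * nielsenS (x.1 + 1) (x.2 + 1) 1

/-- The coefficients of the logarithm of the same function. -/
def logBetaSeriesCoeff (r : ℝ) : ℕ → ℝ
  | 0 => 0
  | 1 => 0
  | k + 2 => (1 + r ^ (k + 2) - (1 + r) ^ (k + 2)) / ((k : ℝ) + 2) * realZeta (k + 2)

/-- On the line `y = r x` the double series is grouped by total degree. The variable is `-x` because
the expansion is in `-x` and `-y`. -/
theorem hasSum_betaSeries {r x : ℝ} (hr : 0 < r) (hx : 0 < x) (hx1 : x * (1 + r) < 1) :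
    HasSum (fun n => betaSeriesCoeff r n * (-x) ^ n)
      (Real.Gamma (1 + x) * Real.Gamma (1 + r * x) / Real.Gamma (1 + (x + r * x))) := by
  have hrx : 0 < r * x := by positivity
  rw [← one_add_mul_integral_eq_Gamma hx hrx]
  have h := (hasSum_nielsenS_mul_pow hx (by nlinarith) hrx (by nlinarith)).mul_left x
  rw [← Finset.HasAntidiagonal.sigmaAntidiagonalEquivProd.hasSum_iff] at h
  have h2 := h.sigma fun p => hasSum_fintype _
  rw [← hasSum_nat_add_iff' 2]
  simp only [Finset.sum_range_succ, Finset.sum_range_zero, betaSeriesCoeff, pow_zero, mul_one,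
    zero_mul, zero_add, add_zero, add_sub_cancel_left]
  refine h2.congr_fun fun p => ?_
  simp only [Function.comp, Finset.HasAntidiagonal.sigmaAntidiagonalEquivProd_apply]
  rw [Finset.univ_eq_attach, Finset.sum_attach (Finset.HasAntidiagonal.antidiagonal p) fun y =>
    x * ((-x) ^ y.1 * (-(r * x)) ^ (y.2 + 1) * nielsenS (y.1 + 1) (y.2 + 1) 1),
    neg_mul, Finset.sum_mul, ← Finset.sum_neg_distrib]
  refine Finset.sum_congr rfl fun y hy => ?_
  rw [← Finset.HasAntidiagonal.mem_antidiagonal.1 hy, neg_mul_eq_mul_neg r x, mul_pow]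
  ring

theorem hasSum_logBetaSeries {r x : ℝ} (hr : 0 < r) (hx : 0 < x) (hx1 : x * (1 + r) < 1) :
    HasSum (fun n => logBetaSeriesCoeff r n * (-x) ^ n)
      (Real.log (Real.Gamma (1 + x) * Real.Gamma (1 + r * x) / Real.Gamma (1 + (x + r * x)))) := by
  have hrx : 0 < r * x := by positivity
  have g1 := (Real.Gamma_pos_of_pos (show 0 < 1 + x by linarith)).ne'
  have g2 := (Real.Gamma_pos_of_pos (show 0 < 1 + r * x by linarith)).ne'
  have g3 := (Real.Gamma_pos_of_pos (show 0 < 1 + (x + r * x) by linarith)).ne'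
  rw [Real.log_div (mul_ne_zero g1 g2) g3, Real.log_mul g1 g2, ← hasSum_nat_add_iff' 2]
  have h := hasSum_log_Gamma_add_sub_zeta hx hrx (by linarith)
  simp only [Finset.sum_range_succ, Finset.sum_range_zero, logBetaSeriesCoeff, zero_mul, add_zero,
    sub_zero]
  refine h.congr_fun fun k => ?_
  rw [show x + r * x = (1 + r) * x by ring, mul_pow, mul_pow, neg_pow, pow_add (-1 : ℝ)]
  ring

/-- The beta series is the exponential of a series with coefficients in `A`, and exponentiation
preserves this. -/
theorem betaSeriesCoeff_mem (A : Subalgebra ℚ ℝ) (hA : ∀ i, 2 ≤ i → realZeta i ∈ A) {r : ℕ}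
    (hr : 0 < r) (n : ℕ) : betaSeriesCoeff r n ∈ A := by
  have hr' : (0 : ℝ) < r := by exact_mod_cast hr
  set ε : ℝ := 1 / (2 * (1 + r))
  have hε : 0 < ε := by positivity
  have hlt : ∀ x, x ≤ ε → x * (1 + r) < 1 := by
    intro x hx
    calc x * (1 + r) ≤ ε * (1 + r) := by gcongr
      _ = 1 / 2 := by simp only [ε]; field_simp
      _ < 1 := by norm_num
  obtain ⟨hF, hFd⟩ := analyticAt_and_iteratedDeriv_tsum (neg_ne_zero.2 hε.ne')
    (hasSum_betaSeries hr' hε (hlt ε le_rfl)).summable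
  obtain ⟨hL, hLd⟩ := analyticAt_and_iteratedDeriv_tsum (neg_ne_zero.2 hε.ne')
    (hasSum_logBetaSeries hr' hε (hlt ε le_rfl)).summable
  set F : ℝ → ℝ := fun z => ∑' n, betaSeriesCoeff r n * z ^ n
  set H : ℝ → ℝ := fun z => ∑' n, logBetaSeriesCoeff r n * z ^ n
  have hlogmem : ∀ k, logBetaSeriesCoeff r k ∈ A := by
    intro k
    match k with
    | 0 => exact A.zero_mem
    | 1 => exact A.zero_mem
    | k + 2 =>
      refine A.mul_mem ?_ (hA _ (by omega))
      have e : (1 + (r : ℝ) ^ (k + 2) - (1 + (r : ℝ)) ^ (k + 2)) / ((k : ℝ) + 2) =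
          algebraMap ℚ ℝ ((1 + (r : ℚ) ^ (k + 2) - (1 + (r : ℚ)) ^ (k + 2)) / ((k : ℚ) + 2)) := by
        simp
      rw [e]
      exact A.algebraMap_mem _
  have hH0 : H 0 = 0 := by
    have := hLd 0
    simpa [logBetaSeriesCoeff] using this
  have hEq : F =ᶠ[𝓝 0] fun z => Real.exp (H z) := by
    -- The gamma identity is available only for `x = -z > 0`; the identity theorem carries it to a
    -- full neighbourhood of `0`.
    refine (hF.frequently_eq_iff_eventually_eq hL.rexp).1 ?_
    have hev : ∀ᶠ z in 𝓝[<] (0 : ℝ), F z = Real.exp (H z) := by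
      filter_upwards [Ioo_mem_nhdsLT (neg_lt_zero.2 hε)] with z hz
      have hz0 : 0 < -z := by linarith [hz.2]
      have hz1 := hlt (-z) (by linarith [hz.1])
      have e1 := (hasSum_betaSeries hr' hz0 hz1).tsum_eq
      have e2 := (hasSum_logBetaSeries hr' hz0 hz1).tsum_eq
      rw [neg_neg] at e1 e2
      simp only [F, H]
      rw [e1, e2, Real.exp_log]
      have : 0 < r * -z := by positivity
      exact div_pos (mul_pos (Real.Gamma_pos_of_pos (by linarith))
        (Real.Gamma_pos_of_pos (by linarith))) (Real.Gamma_pos_of_pos (by linarith))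
    exact hev.frequently.filter_mono (nhdsWithin_mono _ fun z hz => ne_of_lt hz)
  have hmem := iteratedDeriv_exp_comp_mem A hL (by rw [hH0, Real.exp_zero]; exact A.one_mem)
    (fun k => by rw [hLd]; exact A.mul_mem (natCast_mem A _) (hlogmem k)) n
  rw [← hEq.iteratedDeriv_eq, hFd] at hmem
  have hfac : (n.factorial : ℝ) ≠ 0 := by positivity
  have e : betaSeriesCoeff r n =
      (1 / (n.factorial : ℚ)) • ((n.factorial : ℝ) * betaSeriesCoeff r n) := by
    rw [Rat.smul_def]
    push_cast
    field_simp
  rw [e]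
  exact A.smul_mem hmem _

theorem nielsenS_one_mem (A : Subalgebra ℚ ℝ) (hA : ∀ i, 2 ≤ i → realZeta i ∈ A) (m n : ℕ) :
    nielsenS (m + 1) (n + 1) 1 ∈ A := by
  -- The degree `m + n + 2` coefficient is, up to sign, a polynomial in `r` with `S_{m+n+2-j, j}(1)`
  -- in front of `r^j`. It has no constant term, so `v` is `0` at `j = 0`.
  set v : Fin (m + n + 2) → ℝ := fun j =>
    if (j : ℕ) = 0 then 0 else nielsenS (m + n + 1 - j + 1) j 1 with hv
  have h : v ⟨n + 1, by omega⟩ ∈ A := by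
    refine mem_of_forall_sum_pow_mul_mem A v (fun k => ?_) _
    rw [Fin.sum_univ_eq_sum_range (fun j => (k : ℝ) ^ j *
      if j = 0 then 0 else nielsenS (m + n + 1 - j + 1) j 1) (m + n + 2), Finset.sum_range_succ']
    simp only [add_eq_zero, one_ne_zero, and_false, if_false, if_true, mul_zero, add_zero]
    rcases Nat.eq_zero_or_pos k with rfl | hk
    · simp
    · have hb := A.neg_mem (betaSeriesCoeff_mem A hA hk (m + n + 2))
      rw [betaSeriesCoeff, neg_neg, Finset.Nat.sum_antidiagonal_eq_sum_range_succ_mk,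
        ← Finset.sum_range_reflect] at hb
      convert hb using 1
      refine Finset.sum_congr rfl fun j hj => ?_
      have := Finset.mem_range.1 hj
      have e1 : m + n - (m + n + 1 - 1 - j) = j := by omega
      have e2 : m + n + 1 - (j + 1) = m + n + 1 - 1 - j := by omega
      simp only [Nat.succ_eq_add_one, e1, e2]
  simpa [hv] using h

theorem ofReal_nielsenS_one_mem (m n : ℕ) : ((nielsenS (m + 1) (n + 1) 1 : ℝ) : ℂ) ∈
    Algebra.adjoin ℚ {z : ℂ | ∃ i : ℕ, 2 ≤ i ∧ z = riemannZeta (i : ℂ)} := by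
  set B := Algebra.adjoin ℚ {z : ℂ | ∃ i : ℕ, 2 ≤ i ∧ z = riemannZeta (i : ℂ)}
  -- Pulling the complex algebra back along `ℝ → ℂ` gives a real subalgebra containing the zeta
  -- values.
  have h := nielsenS_one_mem (B.comap (Complex.ofRealAm.restrictScalars ℚ)) (fun i hi => ?_) m n
  · exact h
  · change ((realZeta i : ℝ) : ℂ) ∈ B
    rw [ofReal_realZeta hi]
    exact Algebra.subset_adjoin ⟨i, hi, rfl⟩

end

/-! ### The theorem. -/

theorem theorem1 (f : ℝ → ℝ) (q w : ℝ)
    (hf : AnalyticOnNhd ℝ f (Set.Ioc 0 1))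
    (hint : IntervalIntegrable f volume 0 1)
    (hqw : (-1 < q ∧ q ≤ 1 ∧ w ≠ 0) ∨ (q = -1 ∧ 0 < w)) :
    -- the integrals `I_n` and those defining `S_{m,k}(-q)` converge
    (∀ n : ℕ, 1 ≤ n → IntervalIntegrable (mainIntegrand f q w n) volume 0 1) ∧
    (∀ m k : ℕ, 1 ≤ m → 1 ≤ k → IntervalIntegrable (nielsenIntegrand m k (-q)) volume 0 1) ∧
    -- the asymptotic series
    HasAsymptoticSeries (mainIntegral f q w) (fun p =>
      if p = 0 then ∫ u in (0 : ℝ)..1, f u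
      else if p = 1 then 0
      else expansionCoeff f q w p) ∧
    -- `q = -1`: multiple zeta values, which are rational polynomials in `ζ(2), ζ(3), …`
    (q = -1 → ∀ p : ℕ, 2 ≤ p →
      (∀ l ∈ Finset.Icc 1 (p - 1),
        Tendsto (mzvTrunc (plainArgs (l + 1) (p - l - 1))) atTop
          (𝓝 (mzv (plainArgs (l + 1) (p - l - 1)))) ∧
        ((mzv (plainArgs (l + 1) (p - l - 1)) : ℝ) : ℂ) ∈
          Algebra.adjoin ℚ {z : ℂ | ∃ i : ℕ, 2 ≤ i ∧ z = riemannZeta (i : ℂ)}) ∧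
      expansionCoeff f q w p = ∑ l ∈ Finset.Icc 1 (p - 1),
        (-w) ^ (p - l) * betaCoeff f (l - 1) * mzv (plainArgs (l + 1) (p - l - 1))) ∧
    -- `q = 1`: alternating multiple zeta values
    (q = 1 → ∀ p : ℕ, 2 ≤ p →
      (∀ l ∈ Finset.Icc 1 (p - 1),
        Tendsto (mzvTrunc (barArgs (l + 1) (p - l - 1))) atTop
          (𝓝 (mzv (barArgs (l + 1) (p - l - 1))))) ∧
      expansionCoeff f q w p = ∑ l ∈ Finset.Icc 1 (p - 1),
        (-w) ^ (p - l) * betaCoeff f (l - 1) * mzv (barArgs (l + 1) (p - l - 1))) := by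
  have hq : |q| ≤ 1 := by
    rw [abs_le]
    rcases hqw with ⟨h1, h2, -⟩ | ⟨h, -⟩
    · exact ⟨h1.le, h2⟩
    · constructor <;> linarith
  have index : ∀ p l : ℕ, l ∈ Finset.Icc 1 (p - 1) →
      ∃ m k, l = m + 1 ∧ p - l = k + 1 ∧ p - l - 1 = k := by
    intro p l hl
    have := Finset.mem_Icc.1 hl
    exact ⟨l - 1, p - l - 1, by omega, by omega, rfl⟩
  refine ⟨fun n _ => intervalIntegrable_mainIntegrand hint hqw n,
    fun m k _ hk => intervalIntegrable_nielsenIntegrand hq m hk,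
    hasAsymptoticSeries_mainIntegral (hf 1 ⟨one_pos, le_rfl⟩) hint hq hqw, ?_, ?_⟩
  · rintro rfl p -
    refine ⟨fun l hl => ?_, Finset.sum_congr rfl fun l hl => ?_⟩
    · obtain ⟨m, k, rfl, -, hk⟩ := index p l hl
      rw [hk, mzv_plainArgs]
      exact ⟨tendsto_mzvTrunc_plainArgs m k, ofReal_nielsenS_one_mem m k⟩
    · obtain ⟨m, k, rfl, hk, hk'⟩ := index p l hl
      rw [hk', hk, mzv_plainArgs, neg_neg]
  · rintro rfl p -
    refine ⟨fun l hl => ?_, Finset.sum_congr rfl fun l hl => ?_⟩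
    · obtain ⟨m, k, rfl, -, hk⟩ := index p l hl
      rw [hk, mzv_barArgs]
      exact tendsto_mzvTrunc_barArgs m k
    · obtain ⟨m, k, rfl, hk, hk'⟩ := index p l hl
      rw [hk', hk, mzv_barArgs]
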